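/- Let $M=(\mathcal S,\mathcal A,r,P,d_1,H)$ be a finite-horizon MDP with finite state and action sets, transition laws $P_h(\cdot\mid s,a)$ of $s_{h+1}$ given $(s_h,a_h)=(s,a)$, rewards $r_h(s,a)\in[-1,1]$ and initial distribution $d_1$. For a policy $\pi=\{\pi_h(\cdot\mid s)\}_{h=1}^H$ let $d^\pi_h(s,a)$ be the probability that $(s_h,a_h)=(s,a)$ under $\pi$, $d^\pi_h(s)=\sum_a d^\pi_h(s,a)$, $V^\pi_h$ the value functions ($V^\pi_{H+1}=0$) and $v^\pi=\mathbb E_\pi[\sum_{h=1}^H r_h(s_h,a_h)]$. *Quasi-adaptive process.* In round $i=1,\dots,n$ a (possibly randomized) logging algorithm $\mathcal E$ chooses a policy $\mu^i$ as a function of the first trajectories $\tau_1,\dots,\tau_{i-1}$ (and of its own internal randomness), and $\mu^i$ is run twice in $M$, independently, which yields $\tau_i$ and a shadow trajectory $\tau_i'$; the shadow trajectories never influence the policies. *Estimator.* From $\mathcal D_{shadow}=\{\tau'_i\}_{i=1}^n$ let $n_{h,s,a}$ and $n_{h,s,a,s'}$ count the visits to $(s,a)$ at time $h$ and the transitions from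 there to $s'$; let $\hat P_h(s'\mid s,a)=n_{h,s,a,s'}/n_{h,s,a}$, let $\hat r_h(s,a)$ be the average observed reward (both $0$ if $n_{h,s,a}=0$), let $\hat d^\pi_1$ be the empirical distribution of the initial states, $\hat d^\pi_{h+1}(s')=\sum_{s,a}\hat d^\pi_h(s)\pi_h(a\mid s)\hat P_h(s'\mid s,a)$, and $$\hat v^\pi=\sum_{h=1}^H\sum_{s,a}\hat d^\pi_h(s)\,\pi_h(a\mid s)\,\hat r_h(s,a).$$ *The non-adaptive bound.* For a tuple of policies $\mu=(\mu^1,\dots,\mu^n)$ put $\bar d^\mu_h(s,a)=\frac1n\sum_i d^{\mu^i}_h(s,a)$, $\bar d_m(\mu)=\min_{h,s,a}\bar d^\mu_h(s,a)$, $\tau_s=\max_{h,s,a}\frac{d^\pi_h(s,a)}{\bar d^\mu_h(s,a)}$, $\tau_a=\max_{h,s,a}\frac{\pi_h(a\mid s)}{\frac1n\sum_i\mu^i_h(a\mid s)}$, $\psi_{h,s,a}=\mathrm{Var}_{s'\sim P_h(\cdot\mid s,a)}[r_h(s,a)+V^\pi_{h+1}(s')]$, and $$B_C(\mu)=\frac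 Cn\Big(\mathrm{Var}_{s_1\sim d_1}[V_1^\pi(s_1)]+\sum_{h=1}^H\sum_{s,a}\frac{d^\pi_h(s)^2\,\pi_h(a\mid s)^2}{\bar d^\mu_h(s,a)}\,\psi_{h,s,a}\Big)+C\,\frac{\tau_a^2\,\tau_s\,H^3}{n^2\,\bar d_m(\mu)} .$$ **Statement.** There is an absolute constant $C>0$ such that the following holds for every $M$, $\pi$, $n$ and $\mathcal E$ as above, every $\delta\in[0,1]$ and every $\bar d_m>0$ with $n>16\log(n)/\bar d_m$. Let $G$ be the event that the generated policies satisfy $\frac1n\sum_i d^{\mu^i}_h(s,a)\ge\bar d_m$ for all $h,s,a$. If $\mathbb P(G)\ge1-\delta$, then $$\mathrm{MSE}(\hat v^\pi)=\mathbb E\big[(\hat v^\pi-v^\pi)^2\big]\le(1-\delta)\,\mathbb E\big[B_C(\mu^1,\dots,\mu^n)\,\big|\,G\big]+H^2\delta$$ (if $\mathbb P(G)=0$, which forces $\delta=1$, the first term is $0$). -/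

import Mathlib

open MeasureTheory ProbabilityTheory

namespace OPE

/-- A tabular finite-horizon Markov decision process with time steps `0, …, H - 1`.
`P h s a` is the law of the state at time `h + 1` after playing `a` in state `s` at time `h`. -/
structure MDP (S A : Type*) [Fintype S] [Fintype A] (H : ℕ) where
  P : Fin H → S → A → stdSimplex ℝ S
  r : Fin H → S → A → ℝ
  r_mem : ∀ h s a, r h s a ∈ Set.Icc (-1 : ℝ) 1
  d₁ : stdSimplex ℝ S

/-- A (randomized, non-stationary) policy. -/
abbrev Policy (S A : Type*) [Fintype A] (H : ℕ) : Type _ := Fin H → S → stdSimplex ℝ A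

/-- The states and actions of a trajectory. The rewards are functions of these, see `observe`. -/
def Trajectory (S A : Type*) (H : ℕ) : Type _ := Fin H → S × A

noncomputable instance (S A : Type*) [Fintype S] [Fintype A] (H : ℕ) :
    Fintype (Trajectory S A H) :=
  inferInstanceAs (Fintype (Fin H → S × A))

instance (S A : Type*) (H : ℕ) : MeasurableSpace (Trajectory S A H) := ⊤

/-- Observed data: `n` trajectories of (state, action, reward) triples. -/
abbrev Dataset (S A : Type*) (H n : ℕ) : Type _ := Fin n → Fin H → S × A × ℝ

/-- The variance of `f` under the probability vector `p`. -/
noncomputable def simplexVar {X : Type*} [Fintype X] (p : stdSimplex ℝ X) (f : X → ℝ) : ℝ :=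
  ∑ x, p.1 x * (f x - ∑ y, p.1 y * f y) ^ 2

/-! ### The estimator, as a function of the data and of the target policy only -/

section Estimator

variable {S A : Type*} [Fintype S] [Fintype A] {H n : ℕ}

open Classical in
/-- The number of visits to `(s, a)` at time `h`. -/
noncomputable def visits (D : Dataset S A H n) (h : Fin H) (s : S) (a : A) : ℕ :=
  (Finset.univ.filter fun i : Fin n => (D i h).1 = s ∧ (D i h).2.1 = a).card

open Classical in
/-- The number of transitions from `(s, a)` at time `h` to `s'` at time `h + 1`. -/
noncomputable def transitions (D : Dataset S A H n) (h : Fin H) (s : S) (a : A) (s' : S) : ℕ :=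
  (Finset.univ.filter fun i : Fin n => (D i h).1 = s ∧ (D i h).2.1 = a ∧
    ∃ hn : h.val + 1 < H, (D i ⟨h.val + 1, hn⟩).1 = s').card

/-- Plug-in transition estimate. It is `0` when `(h, s, a)` is not visited, as `x / 0 = 0`. -/
noncomputable def PHat (D : Dataset S A H n) (h : Fin H) (s : S) (a : A) (s' : S) : ℝ :=
  (transitions D h s a s' : ℝ) / (visits D h s a : ℝ)

open Classical in
/-- Plug-in reward estimate. It is `0` when `(h, s, a)` is not visited, as `x / 0 = 0`. -/
noncomputable def rHat (D : Dataset S A H n) (h : Fin H) (s : S) (a : A) : ℝ :=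
  (∑ i : Fin n, if (D i h).1 = s ∧ (D i h).2.1 = a then (D i h).2.2 else 0) /
    (visits D h s a : ℝ)

open Classical in
/-- The estimated state distribution at time `k` under `π`: the empirical distribution of the
initial states at time `0`, pushed forward by the estimated transitions of `π`. -/
noncomputable def dHat (π : Policy S A H) (D : Dataset S A H n) : ℕ → S → ℝ
  | 0, s => if hH : 0 < H then
      ((Finset.univ.filter fun i : Fin n => (D i ⟨0, hH⟩).1 = s).card : ℝ) / (n : ℝ) else 0
  | k + 1, s' => if hk : k < H then
      ∑ s, dHat π D k s * ∑ a, (π ⟨k, hk⟩ s).1 a * PHat D ⟨k, hk⟩ s a s' else 0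

/-- The tabular marginalized importance sampling estimate of the value of `π`. -/
noncomputable def tmis (π : Policy S A H) (D : Dataset S A H n) : ℝ :=
  ∑ h : Fin H, ∑ s, dHat π D h.val s * ∑ a, (π h s).1 a * rHat D h s a

end Estimator

namespace MDP

variable {S A : Type*} [Fintype S] [Fintype A] {H n : ℕ} (M : MDP S A H)

/-- The trajectory together with the rewards collected along it. -/
def observe (τ : Trajectory S A H) : Fin H → S × A × ℝ :=
  fun h => ((τ h).1, (τ h).2, M.r h (τ h).1 (τ h).2)

/-- The probability of the trajectory `τ` when `π` is run in `M`. -/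
noncomputable def trajProb (π : Policy S A H) (τ : Trajectory S A H) : ℝ :=
  ∏ h : Fin H,
    (if h.val = 0 then M.d₁.1 (τ h).1
      else
        let p : Fin H := ⟨h.val - 1, by omega⟩
        (M.P p (τ p).1 (τ p).2).1 (τ h).1) *
    (π h (τ h).1).1 (τ h).2

open Classical in
/-- `d^π_h(s, a)`: the probability that `(s_h, a_h) = (s, a)` under `π`. -/
noncomputable def occ (π : Policy S A H) (h : Fin H) (s : S) (a : A) : ℝ :=
  ∑ τ : Trajectory S A H, if τ h = (s, a) then M.trajProb π τ else 0

/-- `d^π_h(s)`: the probability that `s_h = s` under `π`. -/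
noncomputable def stateOcc (π : Policy S A H) (h : Fin H) (s : S) : ℝ :=
  ∑ a, M.occ π h s a

/-- The value `v^π`: the expected total reward of a trajectory of `π`. -/
noncomputable def value (π : Policy S A H) : ℝ :=
  ∑ τ : Trajectory S A H, M.trajProb π τ * ∑ h : Fin H, M.r h (τ h).1 (τ h).2

/-- Expected reward of `π` from state `s` over the last `k` time steps `H - k, …, H - 1`. -/
noncomputable def valueToGo (π : Policy S A H) : ℕ → S → ℝ
  | 0, _ => 0
  | k + 1, s => if hk : k < H then
      let h : Fin H := ⟨H - 1 - k, by omega⟩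
      ∑ a, (π h s).1 a * (M.r h s a + ∑ s', (M.P h s a).1 s' * valueToGo π k s') else 0

/-- The value function `V^π_h(s)`, with `V^π_H = 0` (time starts at `0`). -/
noncomputable def V (π : Policy S A H) (h : ℕ) (s : S) : ℝ := M.valueToGo π (H - h) s

/-- `ψ_{h,s,a} = Var[r_h + V^π_{h+1}(s_{h+1}) | s_h = s, a_h = a]`. -/
noncomputable def psi (π : Policy S A H) (h : Fin H) (s : S) (a : A) : ℝ :=
  simplexVar (M.P h s a) fun s' => M.r h s a + M.V π (h.val + 1) s'

/-- The average occupancy `(1/n) ∑ᵢ d^{μ^i}_h(s, a)` of the logging policies. -/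
noncomputable def avgOcc (μ : Fin n → Policy S A H) (h : Fin H) (s : S) (a : A) : ℝ :=
  (1 / (n : ℝ)) * ∑ i, M.occ (μ i) h s a

/-- `min_{h,s,a} (1/n) ∑ᵢ d^{μ^i}_h(s, a)`. -/
noncomputable def minExploration (μ : Fin n → Policy S A H) : ℝ :=
  ⨅ x : Fin H × S × A, M.avgOcc μ x.1 x.2.1 x.2.2

/-- `τ_s = max_{h,s,a} d^π_h(s, a) / ((1/n) ∑ᵢ d^{μ^i}_h(s, a))`. -/
noncomputable def tauS (π : Policy S A H) (μ : Fin n → Policy S A H) : ℝ :=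
  ⨆ x : Fin H × S × A, M.occ π x.1 x.2.1 x.2.2 / M.avgOcc μ x.1 x.2.1 x.2.2

/-- The bound on the mean squared error for the fixed logging policies `μ`, with constant `C`.
The summand `simplexVar M.d₁ (M.V π 0)` is the term of the sum over time that belongs to the
draw of the initial state. -/
noncomputable def nopeBound (C : ℝ) (π : Policy S A H) (μ : Fin n → Policy S A H) : ℝ :=
  let tauA : ℝ := ⨆ x : Fin H × S × A,
    (π x.1 x.2.1).1 x.2.2 / ((1 / (n : ℝ)) * ∑ i, (μ i x.1 x.2.1).1 x.2.2)
  C * ((1 / (n : ℝ)) * (simplexVar M.d₁ (M.V π 0) +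
      ∑ h : Fin H, ∑ s, ∑ a,
        M.stateOcc π h s ^ 2 * (π h s).1 a ^ 2 / M.avgOcc μ h s a * M.psi π h s a)) +
    C * (tauA ^ 2 * M.tauS π μ * (H : ℝ) ^ 3 / ((n : ℝ) ^ 2 * M.minExploration μ))

end MDP

/-- A randomized logging algorithm with internal randomness in `Ξ`: the policy of round `i` is a
function of the internal randomness and of the first trajectories `τ_j` of the rounds `j < i`. -/
structure LoggingAlgorithm (Ξ : Type*) [MeasurableSpace Ξ] (S A : Type*) [Fintype A]
    (H n : ℕ) where
  policy : (i : Fin n) → Ξ → (Fin i.val → Trajectory S A H) → Policy S A H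
  measurable_policy : ∀ i past, Measurable fun u => policy i u past

/-- An outcome `(u, τ, τ')`: internal randomness, first trajectories, shadow trajectories. -/
abbrev Outcome (Ξ S A : Type*) (H n : ℕ) : Type _ :=
  Ξ × (Fin n → Trajectory S A H) × (Fin n → Trajectory S A H)

namespace LoggingAlgorithm

variable {Ξ : Type*} [MeasurableSpace Ξ] {S A : Type*} [Fintype S] [Fintype A] {H n : ℕ}
  (E : LoggingAlgorithm Ξ S A H n)

/-- The logging policies `μ^1, …, μ^n` that the algorithm generates. -/
def policies (ω : Outcome Ξ S A H n) (i : Fin n) : Policy S A H :=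
  E.policy i ω.1 fun j => ω.2.1 ⟨j.val, j.isLt.trans i.isLt⟩

/-- The law of the quasi-adaptive process: `u` is drawn from `ν`, and in each round `i` the
policy `μ^i` is run twice, independently, which yields `τ_i` and `τ'_i`. -/
noncomputable def law (M : MDP S A H) (ν : Measure Ξ) : Measure (Outcome Ξ S A H n) :=
  (ν.prod Measure.count).withDensity fun ω => ENNReal.ofReal
    (∏ i, M.trajProb (E.policies ω i) (ω.2.1 i) * M.trajProb (E.policies ω i) (ω.2.2 i))

/-- The mean squared error of the estimate of `v^π` computed from the shadow trajectories. -/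
noncomputable def shadowMSE (M : MDP S A H) (ν : Measure Ξ) (π : Policy S A H) : ℝ :=
  ∫ ω, (tmis π (fun i => M.observe (ω.2.2 i)) - M.value π) ^ 2 ∂(E.law M ν)

/-- The event that the average exploration of the generated policies is at least `dm`. -/
def explorationEvent (M : MDP S A H) (dm : ℝ) : Set (Outcome Ξ S A H n) :=
  {ω | ∀ h s a, dm ≤ M.avgOcc (E.policies ω) h s a}

end LoggingAlgorithm

end OPE

/-!
The proof first bounds the error for fixed logging policies `μ` and then averages over the policies
that the algorithm generates.

Fixed policies. Given what all trajectories do before time `k`, their states at time `k` are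
independent with laws that do not depend on the logging policies (`MDP.dataExp_state`). So every
step of the estimator is conditionally unbiased at the visited pairs. To make it unbiased at all
pairs, the fictitious estimator `MDP.dTilde` uses the true transition law at the pairs with less
than half of the expected number of visits. Its error is a sum of martingale differences, and
`MDP.dataExp_fictitious_sq_le` computes the second moment. This involves `E dTilde_t(s)²`, where
the error of `dTilde_t(s)` has second moment of order `τ_s d_t(s) / n`
(`MDP.dataExp_dTilde_sub_sq_le`): the same second moment formula, applied to the reward
`1{s_T = s}`, gives a recursion, and the law of total variance (`MDP.simplexVar_add_sum_le`) keeps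
it from growing with the horizon, so that the assumption on `n` suffices to close it. A Chernoff bound (`MDP.dataExp_visits_lt`) shows that the
fictitious estimator differs from the real one with probability at most `H |S| |A| / n²`, where
`|S| |A|` is at most the inverse of the minimal exploration. The result is `MDP.mse_le_nopeBound`.

Averaging. Off the exploration event only `H² δ` is available, although the error itself may be
as large as `2 H`. But the mean squared error is at most `H²` for all logging policies
(`MDP.mse_le_sq`), because the estimator underestimates nonnegative rewards in the mean: its bias
is paid for by mass that has left the estimated state distribution and no longer contributes to
the variance. Integrating out the shadow trajectories (`LoggingAlgorithm.shadowMSE_eq_integral_mse`)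
reduces the theorem to `mse ≤ min (nopeBound, H²)` on the exploration event and `mse ≤ H²` off it.
-/

namespace OPE

/-! ### Weights of adapted processes on finite path spaces -/

section AdaptedWeights

variable {N : ℕ} {X : Type*} [Fintype X]

/-- Resampling one coordinate of a path covers every path `card X` times. -/
lemma sum_sum_update (k : Fin N) (G : (Fin N → X) → ℝ) :
    ∑ ω, ∑ x, G (Function.update ω k x) = Fintype.card X * ∑ ω, G ω := by
  classical
  let e : (Fin N → X) × X ≃ (Fin N → X) × X :=
    { toFun := fun p => (Function.update p.1 k p.2, p.1 k)
      invFun := fun p => (Function.update p.1 k p.2, p.1 k)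
      left_inv := fun p => by simp
      right_inv := fun p => by simp }
  have h := Equiv.sum_comp e fun p => G p.1
  rw [Fintype.sum_prod_type, Fintype.sum_prod_type] at h
  simpa [e, Finset.mul_sum] using h

variable [Nonempty X] {q : Fin N → (Fin N → X) → ℝ}

/-- The weight of a path whose first `k` steps follow `q` and whose later steps are uniform. -/
noncomputable def truncatedWeight (q : Fin N → (Fin N → X) → ℝ) (k : ℕ) (ω : Fin N → X) : ℝ :=
  ∏ j : Fin N, if j.val < k then q j ω else (Fintype.card X : ℝ)⁻¹

lemma truncatedWeight_update (hq : ∀ k, DependsOn (q k) {j | j ≤ k}) (k : Fin N)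
    (ω : Fin N → X) (x : X) :
    truncatedWeight q (k + 1) (Function.update ω k x) =
      Fintype.card X * (truncatedWeight q k ω * q k (Function.update ω k x)) := by
  classical
  unfold truncatedWeight
  rw [← Finset.mul_prod_erase _ _ (Finset.mem_univ k), ← Finset.mul_prod_erase _
    (fun j : Fin N => if j.val < k.val then q j ω else (Fintype.card X : ℝ)⁻¹) (Finset.mem_univ k)]
  have hc : (Fintype.card X : ℝ) ≠ 0 := by simp
  have h : ∏ j ∈ Finset.univ.erase k, (if j.val < k.val + 1 then q j (Function.update ω k x)
        else (Fintype.card X : ℝ)⁻¹) =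
      ∏ j ∈ Finset.univ.erase k, if j.val < k.val then q j ω else (Fintype.card X : ℝ)⁻¹ := by
    refine Finset.prod_congr rfl fun j hj => ?_
    have hjk : j.val ≠ k.val := fun h => (Finset.mem_erase.1 hj).1 (Fin.ext h)
    by_cases hlt : j.val < k.val
    · rw [if_pos (by omega), if_pos hlt]
      refine hq j fun i hi => Function.update_of_ne ?_ _ _
      rintro rfl
      exact absurd hi (by simp [Fin.lt_def, hlt])
    · rw [if_neg (by omega), if_neg hlt]
  rw [h]
  simp
  field_simp

lemma sum_truncatedWeight_succ (hq : ∀ k, DependsOn (q k) {j | j ≤ k}) (k : Fin N)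
    (G : (Fin N → X) → ℝ) :
    ∑ ω, truncatedWeight q (k + 1) ω * G ω =
      ∑ ω, truncatedWeight q k ω *
        ∑ x, q k (Function.update ω k x) * G (Function.update ω k x) := by
  have hc : (Fintype.card X : ℝ) ≠ 0 := by simp
  refine mul_left_cancel₀ hc ?_
  rw [← sum_sum_update k, Finset.mul_sum]
  refine Finset.sum_congr rfl fun ω _ => ?_
  rw [Finset.mul_sum, Finset.mul_sum]
  refine Finset.sum_congr rfl fun x _ => ?_
  rw [truncatedWeight_update hq]
  ring

lemma sum_truncatedWeight_eq (hq : ∀ k, DependsOn (q k) {j | j ≤ k})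
    (hq1 : ∀ k ω, ∑ x, q k (Function.update ω k x) = 1) {k : ℕ} (hk : k ≤ N)
    {G : (Fin N → X) → ℝ} (hG : DependsOn G {j | j.val < k}) :
    ∑ ω, (∏ j, q j ω) * G ω = ∑ ω, truncatedWeight q k ω * G ω := by
  have key : ∀ m, k ≤ m → m ≤ N →
      ∑ ω, truncatedWeight q m ω * G ω = ∑ ω, truncatedWeight q k ω * G ω := by
    intro m hkm
    induction m, hkm using Nat.le_induction with
    | base => intro _; rfl
    | succ m hkm ih =>
      intro hm
      rw [← ih (by omega)]
      refine (sum_truncatedWeight_succ hq ⟨m, hm⟩ G).trans ?_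
      refine Finset.sum_congr rfl fun ω _ => ?_
      have h : ∀ x, G (Function.update ω ⟨m, hm⟩ x) = G ω := fun x =>
        hG fun i hi => Function.update_of_ne (by
          rintro rfl
          simp only [Set.mem_ofPred_eq] at hi
          omega) _ _
      simp_rw [h, ← Finset.sum_mul, hq1, one_mul]
  rw [← key N hk le_rfl]
  refine Finset.sum_congr rfl fun ω _ => ?_
  simp [truncatedWeight]

/-- Conditioning on the coordinates before `k`: coordinate `k` is integrated out with `q k`. -/
lemma sum_prod_mul_eq_sum_update (hq : ∀ k, DependsOn (q k) {j | j ≤ k})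
    (hq1 : ∀ k ω, ∑ x, q k (Function.update ω k x) = 1) (k : Fin N)
    {G : (Fin N → X) → ℝ} (hG : DependsOn G {j | j ≤ k}) :
    ∑ ω, (∏ j, q j ω) * G ω =
      ∑ ω, (∏ j, q j ω) * ∑ x, q k (Function.update ω k x) * G (Function.update ω k x) := by
  rw [sum_truncatedWeight_eq hq hq1 (k := k + 1) k.isLt
      (fun x y h => hG fun i hi => h i (Nat.lt_succ_of_le hi)),
    sum_truncatedWeight_succ hq, sum_truncatedWeight_eq hq hq1 (k := k) k.isLt.le]
  intro ω ω' h
  refine Finset.sum_congr rfl fun x _ => ?_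
  have hu : ∀ i ∈ {j : Fin N | j ≤ k}, Function.update ω k x i = Function.update ω' k x i := by
    intro i hi
    by_cases hik : i = k
    · subst hik; simp
    · rw [Function.update_of_ne hik, Function.update_of_ne hik]
      exact h i (lt_of_le_of_ne hi hik)
  rw [hq k hu, hG hu]

lemma sum_prod_eq_one (hq : ∀ k, DependsOn (q k) {j | j ≤ k})
    (hq1 : ∀ k ω, ∑ x, q k (Function.update ω k x) = 1) :
    ∑ ω, ∏ j, q j ω = 1 := by
  have h := sum_truncatedWeight_eq hq hq1 (k := 0) (Nat.zero_le _)
    (G := fun _ => 1) (fun _ _ _ => rfl)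
  simp only [mul_one] at h
  rw [h]
  simp [truncatedWeight]

end AdaptedWeights

/-! ### Independent draws from finite distributions -/

section Product

variable {n : ℕ} {S : Type*} [Fintype S]

lemma simplexVar_nonneg (p : stdSimplex ℝ S) (f : S → ℝ) : 0 ≤ simplexVar p f :=
  Finset.sum_nonneg fun x _ => mul_nonneg (p.2.1 x) (sq_nonneg _)

lemma simplexVar_eq (p : stdSimplex ℝ S) (f : S → ℝ) :
    simplexVar p f = ∑ x, p.1 x * f x ^ 2 - (∑ x, p.1 x * f x) ^ 2 := by
  unfold simplexVar
  set m := ∑ x, p.1 x * f x with hm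
  have h : ∀ x, p.1 x * (f x - m) ^ 2 = p.1 x * f x ^ 2 - 2 * m * (p.1 x * f x) + m ^ 2 * p.1 x :=
    fun x => by ring
  simp_rw [h, Finset.sum_add_distrib, Finset.sum_sub_distrib, ← Finset.mul_sum, ← hm]
  rw [p.2.2]
  ring

lemma simplexVar_const_add (p : stdSimplex ℝ S) (c : ℝ) (f : S → ℝ) :
    simplexVar p (fun x => c + f x) = simplexVar p f := by
  unfold simplexVar
  simp_rw [mul_add, Finset.sum_add_distrib, ← Finset.sum_mul]
  rw [p.2.2]
  refine Finset.sum_congr rfl fun x _ => by ring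

lemma simplexVar_le_sq (p : stdSimplex ℝ S) {f : S → ℝ} {b : ℝ} (hf : ∀ x, |f x| ≤ b) :
    simplexVar p f ≤ b ^ 2 := by
  rw [simplexVar_eq]
  have h : ∑ x, p.1 x * f x ^ 2 ≤ ∑ x, p.1 x * b ^ 2 :=
    Finset.sum_le_sum fun x _ => mul_le_mul_of_nonneg_left
      (sq_le_sq' (abs_le.1 (hf x)).1 (abs_le.1 (hf x)).2) (p.2.1 x)
  rw [← Finset.sum_mul, p.2.2, one_mul] at h
  nlinarith [sq_nonneg (∑ x, p.1 x * f x)]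

lemma sum_prod_mul_prod (p f : Fin n → S → ℝ) :
    ∑ x : Fin n → S, (∏ l, p l (x l)) * ∏ l, f l (x l) = ∏ l, ∑ s, p l s * f l s := by
  classical
  simp_rw [← Finset.prod_mul_distrib]
  rw [Finset.prod_univ_sum, Fintype.piFinset_univ]

lemma sum_prod_simplex_mul (p : Fin n → stdSimplex ℝ S) (i : Fin n) (f : S → ℝ) :
    ∑ x : Fin n → S, (∏ l, (p l).1 (x l)) * f (x i) = ∑ s, (p i).1 s * f s := by
  have h := sum_prod_mul_prod (fun l => (p l).1) fun l s => if l = i then f s else 1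
  rw [Finset.prod_eq_single i] at h
  · simpa using h
  · intro l _ hl
    simpa [hl] using (p l).2.2
  · simp

lemma sum_prod_simplex_eq_one (p : Fin n → stdSimplex ℝ S) :
    ∑ x : Fin n → S, ∏ l, (p l).1 (x l) = 1 := by
  have h := sum_prod_mul_prod (fun l => (p l).1) fun _ _ => 1
  simp only [mul_one, Finset.prod_const_one] at h
  rw [h]
  exact Finset.prod_eq_one fun l _ => (p l).2.2

lemma sum_prod_simplex_mul_mul (p : Fin n → stdSimplex ℝ S) {i j : Fin n} (hij : i ≠ j)
    (f g : S → ℝ) :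
    ∑ x : Fin n → S, (∏ l, (p l).1 (x l)) * (f (x i) * g (x j)) =
      (∑ s, (p i).1 s * f s) * ∑ s, (p j).1 s * g s := by
  have h := sum_prod_mul_prod (fun l => (p l).1)
    fun l s => (if l = i then f s else 1) * if l = j then g s else 1
  rw [← Finset.prod_subset (Finset.subset_univ {i, j}), Finset.prod_pair hij] at h
  · simp only [if_true, if_neg hij, if_neg hij.symm, mul_one, one_mul,
      Finset.prod_mul_distrib] at h
    simpa only [Finset.prod_ite_eq', Finset.mem_univ, if_true] using h
  · intro l _ hl
    simp only [Finset.mem_insert, Finset.mem_singleton, not_or] at hl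
    simpa [hl.1, hl.2] using (p l).2.2

/-- The second moment of a constant plus a weighted sum of independent centred variables. -/
lemma sum_prod_simplex_mul_sq (p : Fin n → stdSimplex ℝ S) (b : ℝ) (c : Fin n → ℝ) (g : S → ℝ) :
    ∑ x : Fin n → S, (∏ l, (p l).1 (x l)) *
        (b + ∑ i, c i * (g (x i) - ∑ s, (p i).1 s * g s)) ^ 2 =
      b ^ 2 + ∑ i, c i ^ 2 * simplexVar (p i) g := by
  classical
  set f : Fin n → S → ℝ := fun i t => c i * (g t - ∑ s, (p i).1 s * g s) with hf
  have hmean : ∀ i, ∑ s, (p i).1 s * f i s = 0 := by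
    intro i
    have h : ∀ s, (p i).1 s * f i s =
        c i * ((p i).1 s * g s) - c i * (∑ s, (p i).1 s * g s) * (p i).1 s := fun s => by
      simp only [hf]; ring
    simp_rw [h, Finset.sum_sub_distrib, ← Finset.mul_sum]
    rw [(p i).2.2]
    ring
  have hvar : ∀ i, ∑ s, (p i).1 s * (f i s * f i s) = c i ^ 2 * simplexVar (p i) g := by
    intro i
    unfold simplexVar
    rw [Finset.mul_sum]
    refine Finset.sum_congr rfl fun s _ => ?_
    simp only [hf]; ring
  have hexp : ∀ x : Fin n → S, (∏ l, (p l).1 (x l)) * (b + ∑ i, f i (x i)) ^ 2 =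
      b ^ 2 * (∏ l, (p l).1 (x l)) + 2 * b * ∑ i, (∏ l, (p l).1 (x l)) * f i (x i) +
        ∑ i, ∑ j, (∏ l, (p l).1 (x l)) * (f i (x i) * f j (x j)) := by
    intro x
    simp_rw [← Finset.mul_sum]
    simp_rw [← Finset.sum_mul]
    ring
  change ∑ x : Fin n → S, (∏ l, (p l).1 (x l)) * (b + ∑ i, f i (x i)) ^ 2 = _
  simp_rw [hexp, Finset.sum_add_distrib]
  rw [← Finset.mul_sum, ← Finset.mul_sum, sum_prod_simplex_eq_one, Finset.sum_comm]
  simp_rw [sum_prod_simplex_mul, hmean]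
  rw [Finset.sum_comm]
  have hcross : ∀ i, ∑ x : Fin n → S, ∑ j, (∏ l, (p l).1 (x l)) * (f i (x i) * f j (x j)) =
      c i ^ 2 * simplexVar (p i) g := by
    intro i
    rw [Finset.sum_comm, Finset.sum_eq_single i]
    · rw [sum_prod_simplex_mul p i fun s => f i s * f i s, hvar]
    · intro j _ hji
      rw [sum_prod_simplex_mul_mul p hji.symm, hmean, zero_mul]
    · simp
  simp_rw [hcross]
  simp

end Product

/-! ### Occupancies and value functions -/

namespace MDP

variable {S A : Type*} [Fintype S] [Fintype A] {H n : ℕ} (M : MDP S A H)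

/-- The conditional law of the state at time `k`, given the trajectory before time `k`. -/
noncomputable def nextLaw (k : Fin H) (τ : Fin H → S × A) : stdSimplex ℝ S :=
  if k.val = 0 then M.d₁
  else M.P ⟨k.val - 1, by omega⟩ (τ ⟨k.val - 1, by omega⟩).1 (τ ⟨k.val - 1, by omega⟩).2

/-- The conditional probability of the state-action pair at time `k`, given the past. -/
noncomputable def stepProb (π : Policy S A H) (k : Fin H) (τ : Fin H → S × A) : ℝ :=
  (M.nextLaw k τ).1 (τ k).1 * (π k (τ k).1).1 (τ k).2

/-- The probability of a path under `π`, as a product of conditional probabilities. -/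
noncomputable def pathProb (π : Policy S A H) (τ : Fin H → S × A) : ℝ :=
  ∏ h, M.stepProb π h τ

lemma trajProb_eq_pathProb (π : Policy S A H) (τ : Trajectory S A H) :
    M.trajProb π τ = M.pathProb π τ := by
  unfold trajProb pathProb stepProb nextLaw
  refine Finset.prod_congr rfl fun h _ => ?_
  by_cases h0 : h.val = 0 <;> simp [h0]

lemma nextLaw_congr (k : Fin H) {τ τ' : Fin H → S × A} (h : ∀ j, j < k → τ j = τ' j) :
    M.nextLaw k τ = M.nextLaw k τ' := by
  unfold nextLaw
  by_cases h0 : k.val = 0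
  · simp [h0]
  · rw [if_neg h0, if_neg h0, h _ (by rw [Fin.lt_def]; simp; omega)]

lemma nextLaw_update (k : Fin H) (τ : Fin H → S × A) (x : S × A) :
    M.nextLaw k (Function.update τ k x) = M.nextLaw k τ :=
  M.nextLaw_congr k fun _ hj => Function.update_of_ne hj.ne _ _

lemma dependsOn_stepProb (π : Policy S A H) (k : Fin H) :
    DependsOn (M.stepProb π k) {j | j ≤ k} := by
  intro τ τ' h
  unfold stepProb
  rw [M.nextLaw_congr k fun j hj => h j hj.le, h k (le_refl k)]

lemma stepProb_update (π : Policy S A H) (k : Fin H) (τ : Fin H → S × A) (x : S × A) :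
    M.stepProb π k (Function.update τ k x) = (M.nextLaw k τ).1 x.1 * (π k x.1).1 x.2 := by
  simp [stepProb, nextLaw_update]

lemma sum_stepProb_update (π : Policy S A H) (k : Fin H) (τ : Fin H → S × A) :
    ∑ x, M.stepProb π k (Function.update τ k x) = 1 := by
  simp_rw [stepProb_update, Fintype.sum_prod_type, ← Finset.mul_sum, (π k _).2.2, mul_one]
  exact (M.nextLaw k τ).2.2

lemma pathProb_nonneg (π : Policy S A H) (τ : Fin H → S × A) : 0 ≤ M.pathProb π τ := by
  unfold pathProb
  exact Finset.prod_nonneg fun h _ => mul_nonneg ((M.nextLaw h τ).2.1 _) ((π h _).2.1 _)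

include M in
lemma nonempty_state : Nonempty S := by
  by_contra h
  rw [not_nonempty_iff] at h
  simpa using M.d₁.2.2

include M in
lemma nonempty_stateAction (π : Policy S A H) (hH : 0 < H) : Nonempty (S × A) := by
  obtain ⟨s⟩ := M.nonempty_state
  by_contra h
  have hA : IsEmpty A := ⟨fun a => h ⟨(s, a)⟩⟩
  simpa using (π ⟨0, hH⟩ s).2.2

include M in
lemma nonempty_path (π : Policy S A H) : Nonempty (Fin H → S × A) := by
  rcases Nat.eq_zero_or_pos H with rfl | hH
  · exact ⟨fun i => i.elim0⟩
  · obtain ⟨x⟩ := M.nonempty_stateAction π hH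
    exact ⟨fun _ => x⟩

lemma sum_pathProb (π : Policy S A H) : ∑ τ : Fin H → S × A, M.pathProb π τ = 1 := by
  rcases Nat.eq_zero_or_pos H with rfl | hH
  · simp [pathProb]
  have := M.nonempty_stateAction π hH
  unfold pathProb
  exact sum_prod_eq_one (M.dependsOn_stepProb π) (M.sum_stepProb_update π)

lemma occ_eq_sum (π : Policy S A H) (h : Fin H) (s : S) (a : A) [DecidableEq (S × A)] :
    M.occ π h s a = ∑ τ : Fin H → S × A, M.pathProb π τ * if τ h = (s, a) then 1 else 0 := by
  unfold occ
  refine Finset.sum_congr rfl fun τ _ => ?_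
  rw [trajProb_eq_pathProb, mul_ite, mul_one, mul_zero]
  split_ifs <;> rfl

lemma occ_nonneg (π : Policy S A H) (h : Fin H) (s : S) (a : A) : 0 ≤ M.occ π h s a := by
  classical
  rw [occ_eq_sum]
  exact Finset.sum_nonneg fun τ _ => mul_nonneg (M.pathProb_nonneg π τ) (by split_ifs <;> simp)

lemma sum_pathProb_mul (π : Policy S A H) (h : Fin H) (f : S → A → ℝ) :
    ∑ τ : Fin H → S × A, M.pathProb π τ * f (τ h).1 (τ h).2 =
      ∑ s, ∑ a, M.occ π h s a * f s a := by
  classical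
  simp_rw [occ_eq_sum, Finset.sum_mul]
  rw [← Fintype.sum_prod_type', Finset.sum_comm]
  refine Finset.sum_congr rfl fun τ _ => ?_
  rw [Finset.sum_eq_single (τ h)]
  · simp
  · intro x _ hx
    simp [hx.symm]
  · simp

lemma sum_occ (π : Policy S A H) (h : Fin H) : ∑ s, ∑ a, M.occ π h s a = 1 := by
  have := M.sum_pathProb_mul π h fun _ _ => 1
  simp only [mul_one] at this
  rw [← this, sum_pathProb]

lemma occ_eq_sum_nextLaw (π : Policy S A H) (h : Fin H) (s : S) (a : A) :
    M.occ π h s a =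
      (∑ τ : Fin H → S × A, M.pathProb π τ * (M.nextLaw h τ).1 s) * (π h s).1 a := by
  classical
  have := M.nonempty_stateAction π h.pos
  rw [occ_eq_sum]
  unfold pathProb
  rw [sum_prod_mul_eq_sum_update (M.dependsOn_stepProb π) (M.sum_stepProb_update π) h
    (G := fun τ => if τ h = (s, a) then 1 else 0)]
  · rw [Finset.sum_mul]
    refine Finset.sum_congr rfl fun τ _ => ?_
    rw [mul_assoc]
    congr 1
    simp [stepProb_update]
  · intro τ τ' hτ
    change (if τ h = (s, a) then (1 : ℝ) else 0) = if τ' h = (s, a) then 1 else 0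
    rw [hτ h (le_refl h)]

lemma stateOcc_eq_sum_nextLaw (π : Policy S A H) (h : Fin H) (s : S) :
    M.stateOcc π h s = ∑ τ : Fin H → S × A, M.pathProb π τ * (M.nextLaw h τ).1 s := by
  unfold stateOcc
  simp_rw [occ_eq_sum_nextLaw, ← Finset.mul_sum]
  rw [(π h s).2.2, mul_one]

lemma occ_eq (π : Policy S A H) (h : Fin H) (s : S) (a : A) :
    M.occ π h s a = M.stateOcc π h s * (π h s).1 a := by
  rw [stateOcc_eq_sum_nextLaw, occ_eq_sum_nextLaw]

lemma stateOcc_nonneg (π : Policy S A H) (h : Fin H) (s : S) : 0 ≤ M.stateOcc π h s :=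
  Finset.sum_nonneg fun a _ => M.occ_nonneg π h s a

lemma sum_stateOcc (π : Policy S A H) (h : Fin H) : ∑ s, M.stateOcc π h s = 1 :=
  M.sum_occ π h

lemma stateOcc_le_one (π : Policy S A H) (h : Fin H) (s : S) : M.stateOcc π h s ≤ 1 := by
  rw [← M.sum_stateOcc π h]
  exact Finset.single_le_sum (fun s _ => M.stateOcc_nonneg π h s) (Finset.mem_univ s)

lemma stateOcc_zero (π : Policy S A H) (hH : 0 < H) (s : S) :
    M.stateOcc π ⟨0, hH⟩ s = M.d₁.1 s := by
  rw [stateOcc_eq_sum_nextLaw]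
  simp only [nextLaw, if_true]
  rw [← Finset.sum_mul, sum_pathProb, one_mul]

lemma stateOcc_succ (π : Policy S A H) {t : ℕ} (ht : t + 1 < H) (s' : S) :
    M.stateOcc π ⟨t + 1, ht⟩ s' =
      ∑ s, ∑ a, M.occ π ⟨t, by omega⟩ s a * (M.P ⟨t, by omega⟩ s a).1 s' := by
  rw [stateOcc_eq_sum_nextLaw, ← sum_pathProb_mul]
  simp [nextLaw]

/-- Pushing the occupancy at time `t` forward: `E f(s_{t+1})` by conditioning on `(s_t, a_t)`. -/
lemma sum_stateOcc_succ_mul (π : Policy S A H) {t : ℕ} (ht : t + 1 < H) (f : S → ℝ) :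
    ∑ s', M.stateOcc π ⟨t + 1, ht⟩ s' * f s' =
      ∑ s, ∑ a, M.occ π ⟨t, by omega⟩ s a *
        ∑ s', (M.P ⟨t, by omega⟩ s a).1 s' * f s' := by
  simp_rw [stateOcc_succ, Finset.sum_mul, Finset.mul_sum]
  rw [Finset.sum_comm]
  refine Finset.sum_congr rfl fun s _ => ?_
  rw [Finset.sum_comm]
  refine Finset.sum_congr rfl fun a _ => Finset.sum_congr rfl fun s' _ => by ring

lemma value_eq (π : Policy S A H) :
    M.value π = ∑ h : Fin H, ∑ s, ∑ a, M.occ π h s a * M.r h s a := by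
  simp_rw [← sum_pathProb_mul]
  rw [Finset.sum_comm]
  simp_rw [← Finset.mul_sum]
  exact Finset.sum_congr rfl fun τ _ => by rw [trajProb_eq_pathProb]

lemma V_of_le (π : Policy S A H) {t : ℕ} (ht : H ≤ t) (s : S) : M.V π t s = 0 := by
  simp [V, Nat.sub_eq_zero_of_le ht, valueToGo]

/-- The Bellman equation. -/
lemma V_eq (π : Policy S A H) (h : Fin H) (s : S) :
    M.V π h s = ∑ a, (π h s).1 a * (M.r h s a + ∑ s', (M.P h s a).1 s' * M.V π (h + 1) s') := by
  obtain ⟨t, ht⟩ := h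
  have h1 : H - t = (H - (t + 1)) + 1 := by omega
  have h2 : H - 1 - (H - (t + 1)) = t := by omega
  have h3 : H - (t + 1) < H := by omega
  simp only [V]
  rw [h1, valueToGo, dif_pos h3]
  simp only [h2]

lemma abs_sum_simplex_mul_le {X : Type*} [Fintype X] (p : stdSimplex ℝ X) {f : X → ℝ} {b : ℝ}
    (hf : ∀ x, |f x| ≤ b) : |∑ x, p.1 x * f x| ≤ b := by
  refine (Finset.abs_sum_le_sum_abs _ _).trans ?_
  calc ∑ x, |p.1 x * f x| ≤ ∑ x, p.1 x * b := by
        refine Finset.sum_le_sum fun x _ => ?_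
        rw [abs_mul, abs_of_nonneg (p.2.1 x)]
        exact mul_le_mul_of_nonneg_left (hf x) (p.2.1 x)
    _ = b := by rw [← Finset.sum_mul, p.2.2, one_mul]

lemma abs_V_le (π : Policy S A H) {t : ℕ} (ht : t ≤ H) (s : S) :
    |M.V π t s| ≤ (H : ℝ) - t := by
  induction ht using Nat.decreasingInduction generalizing s with
  | self => simp [V_of_le]
  | of_succ k hk ih =>
    rw [M.V_eq π ⟨k, hk⟩]
    refine abs_sum_simplex_mul_le _ fun a => (abs_add_le _ _).trans ?_
    have h1 := abs_le.2 (M.r_mem ⟨k, hk⟩ s a)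
    have h2 := abs_sum_simplex_mul_le (M.P ⟨k, hk⟩ s a) ih
    push_cast at h2
    simp only
    linarith

/-- The expected reward before time `T`, plus the expected value-to-go at time `T`, telescopes
to the expected value-to-go at time `0`. -/
lemma sum_occ_reward_add (π : Policy S A H) (ρ : Fin H → S → A → ℝ) (U : ℕ → S → ℝ)
    {T : ℕ} (hT : T < H)
    (hU : ∀ t (ht : t < T) s, U t s = ∑ a, (π ⟨t, by omega⟩ s).1 a *
      (ρ ⟨t, by omega⟩ s a + ∑ s', (M.P ⟨t, by omega⟩ s a).1 s' * U (t + 1) s')) :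
    ∑ t : Fin T, ∑ s, ∑ a, M.occ π ⟨t, by omega⟩ s a * ρ ⟨t, by omega⟩ s a +
      ∑ s, M.stateOcc π ⟨T, hT⟩ s * U T s = ∑ s, M.d₁.1 s * U 0 s := by
  induction T with
  | zero => simp [stateOcc_zero]
  | succ T ih =>
    rw [← ih (by omega) fun t ht s => hU t (by omega) s, Fin.sum_univ_castSucc,
      sum_stateOcc_succ_mul]
    have h : ∀ s, M.stateOcc π ⟨T, by omega⟩ s * U T s = ∑ a, M.occ π ⟨T, by omega⟩ s a *
        (ρ ⟨T, by omega⟩ s a + ∑ s', (M.P ⟨T, by omega⟩ s a).1 s' * U (T + 1) s') := fun s => by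
      rw [hU T (Nat.lt_succ_self T), Finset.mul_sum]
      simp_rw [← mul_assoc, ← M.occ_eq]
    simp_rw [h, mul_add, Finset.sum_add_distrib]
    simp only [Fin.val_castSucc, Fin.val_last]
    ring

lemma value_eq_sum_V (π : Policy S A H) (hH : 0 < H) :
    M.value π = ∑ s, M.d₁.1 s * M.V π 0 s := by
  obtain ⟨T, rfl⟩ : ∃ T, H = T + 1 := ⟨H - 1, by omega⟩
  rw [← M.sum_occ_reward_add π M.r (M.V π) (Nat.lt_succ_self T)
    fun t ht s => M.V_eq π ⟨t, by omega⟩ s, value_eq, Fin.sum_univ_castSucc]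
  congr 1
  refine Finset.sum_congr rfl fun s _ => ?_
  have h := M.V_eq π (Fin.last T) s
  simp only [Fin.val_last] at h
  rw [h, Finset.mul_sum]
  refine Finset.sum_congr rfl fun a _ => ?_
  rw [M.occ_eq, mul_assoc]
  simp only [V_of_le _ _ le_rfl, mul_zero, Finset.sum_const_zero, add_zero]
  rfl

/-- The law of total variance along the Markov chain of `π`, for `U t = E[U T (s_T) | s_t]`:
the one-step variances add up to at most the second moment of the final value. -/
lemma simplexVar_add_sum_le (π : Policy S A H) (U : ℕ → S → ℝ) {T : ℕ} (hT : T < H)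
    (hU : ∀ t (ht : t < T) s, U t s = ∑ a, (π ⟨t, by omega⟩ s).1 a *
      ∑ s', (M.P ⟨t, by omega⟩ s a).1 s' * U (t + 1) s') :
    simplexVar M.d₁ (U 0) + ∑ t : Fin T, ∑ s, ∑ a,
      M.occ π ⟨t, by omega⟩ s a * simplexVar (M.P ⟨t, by omega⟩ s a) (U (t + 1)) ≤
    ∑ s, M.stateOcc π ⟨T, hT⟩ s * U T s ^ 2 := by
  induction T with
  | zero =>
    simp only [stateOcc_zero, Finset.univ_eq_empty, Finset.sum_empty, add_zero, simplexVar_eq]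
    nlinarith [sq_nonneg (∑ s, M.d₁.1 s * U 0 s)]
  | succ T ih =>
    have ih := ih (by omega) fun t ht s => hU t (by omega) s
    rw [Fin.sum_univ_castSucc, ← add_assoc, sum_stateOcc_succ_mul]
    simp only [Fin.val_castSucc, Fin.val_last]
    refine (add_le_add_left ih _).trans ?_
    rw [← Finset.sum_add_distrib]
    refine Finset.sum_le_sum fun s _ => ?_
    -- Jensen's inequality for the choice of the action
    have hJ : U T s ^ 2 ≤ ∑ a, (π ⟨T, by omega⟩ s).1 a *
        (∑ s', (M.P ⟨T, by omega⟩ s a).1 s' * U (T + 1) s') ^ 2 := by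
      have h := simplexVar_nonneg (π ⟨T, by omega⟩ s)
        fun a => ∑ s', (M.P ⟨T, by omega⟩ s a).1 s' * U (T + 1) s'
      rw [simplexVar_eq, ← hU T (Nat.lt_succ_self T)] at h
      linarith
    have h := mul_le_mul_of_nonneg_left hJ (M.stateOcc_nonneg π ⟨T, by omega⟩ s)
    rw [Finset.mul_sum] at h
    simp_rw [← mul_assoc, ← M.occ_eq] at h
    refine (add_le_add_left h _).trans (le_of_eq ?_)
    rw [← Finset.sum_add_distrib]
    refine Finset.sum_congr rfl fun a _ => ?_
    rw [simplexVar_eq]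
    ring

/-- Value functions of the terminal reward `f` at time `T`. -/
lemma exists_backward (π : Policy S A H) {T : ℕ} (hT : T < H) (f : S → ℝ) :
    ∃ U : ℕ → S → ℝ, U T = f ∧ ∀ t (ht : t < T) s, U t s = ∑ a, (π ⟨t, by omega⟩ s).1 a *
      ∑ s', (M.P ⟨t, by omega⟩ s a).1 s' * U (t + 1) s' := by
  induction T generalizing f with
  | zero => exact ⟨fun _ => f, rfl, fun t ht => absurd ht (by omega)⟩
  | succ T ih =>
    obtain ⟨U, hUT, hU⟩ := ih (by omega) fun s => ∑ a, (π ⟨T, by omega⟩ s).1 a *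
      ∑ s', (M.P ⟨T, by omega⟩ s a).1 s' * f s'
    refine ⟨Function.update U (T + 1) f, by simp, fun t ht s => ?_⟩
    rw [Function.update_of_ne (by omega)]
    rcases Nat.lt_succ_iff_lt_or_eq.1 ht with h | rfl
    · rw [Function.update_of_ne (by omega), hU t h]
    · rw [Function.update_self, hUT]

end MDP

/-! ### The law of independent trajectories -/

/-- `F` only depends on what the trajectories do before time `k`. -/
def AdaptedBefore {X β : Type*} {H n : ℕ} (k : ℕ) (F : (Fin n → Fin H → X) → β) : Prop :=
  ∀ ω ω', (∀ i h, h.val < k → ω i h = ω' i h) → F ω = F ω'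

namespace MDP

variable {S A : Type*} [Fintype S] [Fintype A] {H n : ℕ} (M : MDP S A H)

/-- The expectation of `F` when the trajectories `ω i` are drawn independently, `ω i` under the
policy `μ i`. -/
noncomputable def dataExp (μ : Fin n → Policy S A H) (F : (Fin n → Fin H → S × A) → ℝ) : ℝ :=
  ∑ ω, (∏ i, M.pathProb (μ i) (ω i)) * F ω

variable (μ : Fin n → Policy S A H) {F G : (Fin n → Fin H → S × A) → ℝ}

lemma dataProb_nonneg (ω : Fin n → Fin H → S × A) : 0 ≤ ∏ i, M.pathProb (μ i) (ω i) :=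
  Finset.prod_nonneg fun _ _ => M.pathProb_nonneg _ _

lemma dataExp_mono (h : ∀ ω, F ω ≤ G ω) : M.dataExp μ F ≤ M.dataExp μ G :=
  Finset.sum_le_sum fun ω _ => mul_le_mul_of_nonneg_left (h ω) (M.dataProb_nonneg μ ω)

lemma dataExp_nonneg (h : ∀ ω, 0 ≤ F ω) : 0 ≤ M.dataExp μ F :=
  Finset.sum_nonneg fun ω _ => mul_nonneg (M.dataProb_nonneg μ ω) (h ω)

lemma dataExp_add (F G : (Fin n → Fin H → S × A) → ℝ) :
    M.dataExp μ (fun ω => F ω + G ω) = M.dataExp μ F + M.dataExp μ G := by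
  simp [dataExp, mul_add, Finset.sum_add_distrib]

lemma dataExp_sub (F G : (Fin n → Fin H → S × A) → ℝ) :
    M.dataExp μ (fun ω => F ω - G ω) = M.dataExp μ F - M.dataExp μ G := by
  simp [dataExp, mul_sub, Finset.sum_sub_distrib]

lemma dataExp_mul_const (F : (Fin n → Fin H → S × A) → ℝ) (c : ℝ) :
    M.dataExp μ (fun ω => F ω * c) = M.dataExp μ F * c := by
  simp [dataExp, ← mul_assoc, ← Finset.sum_mul]

lemma dataExp_sum {ι : Type*} (s : Finset ι) (F : ι → (Fin n → Fin H → S × A) → ℝ) :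
    M.dataExp μ (fun ω => ∑ j ∈ s, F j ω) = ∑ j ∈ s, M.dataExp μ (F j) := by
  simp only [dataExp, Finset.mul_sum]
  exact Finset.sum_comm

lemma dataExp_prod (f : Fin n → (Fin H → S × A) → ℝ) :
    M.dataExp μ (fun ω => ∏ i, f i (ω i)) = ∏ i, ∑ τ, M.pathProb (μ i) τ * f i τ :=
  sum_prod_mul_prod (fun i => M.pathProb (μ i)) f

lemma dataExp_const (c : ℝ) : M.dataExp μ (fun _ => c) = c := by
  have h := M.dataExp_prod μ fun _ _ => 1
  simp only [Finset.prod_const_one, mul_one, sum_pathProb] at h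
  have h2 := M.dataExp_mul_const μ (fun _ => 1) c
  simpa [h] using h2

/-- Given all trajectories before time `k`, the states at time `k` are independent and the `i`-th
one is drawn from `nextLaw k (ω i)`, whatever the logging policies are. -/
lemma dataExp_state (k : Fin H) (G : (Fin n → Fin H → S × A) → (Fin n → S) → ℝ)
    (hG : AdaptedBefore k G) :
    M.dataExp μ (fun ω => G ω fun i => (ω i k).1) =
      M.dataExp μ fun ω => ∑ x : Fin n → S, (∏ i, (M.nextLaw k (ω i)).1 (x i)) * G ω x := by
  classical
  rcases Nat.eq_zero_or_pos n with rfl | hn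
  · refine Finset.sum_congr rfl fun ω _ => ?_
    simp [Subsingleton.elim (fun i : Fin 0 => (ω i k).1) default]
  have := M.nonempty_stateAction (μ ⟨0, hn⟩) k.pos
  -- all trajectories together form one path with steps in `Fin n → S × A`
  set q : Fin H → (Fin H → Fin n → S × A) → ℝ :=
    fun h η => ∏ i, M.stepProb (μ i) h fun t => η t i with hq
  have hu : ∀ (η : Fin H → Fin n → S × A) (h : Fin H) (x : Fin n → S × A) (i : Fin n),
      (fun t => Function.update η h x t i) = Function.update (fun t => η t i) h (x i) := by
    intro η h x i
    funext t
    by_cases hth : t = h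
    · subst hth; simp
    · simp [hth]
  have hqu : ∀ h η x, q h (Function.update η h x) =
      ∏ i, (M.nextLaw h fun t => η t i).1 (x i).1 * (μ i h (x i).1).1 (x i).2 := by
    intro h η x
    simp only [hq, hu, stepProb_update]
  have hfst : ∀ (η : Fin H → Fin n → S × A) (h : Fin H) (g : (Fin n → S) → ℝ),
      ∑ x : Fin n → S × A, q h (Function.update η h x) * g (fun i => (x i).1) =
        ∑ y : Fin n → S, (∏ i, (M.nextLaw h fun t => η t i).1 (y i)) * g y := by
    intro η h g
    rw [← Equiv.sum_comp (Equiv.arrowProdEquivProdArrow (Fin n) (fun _ => S) fun _ => A).symm,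
      Fintype.sum_prod_type]
    refine Finset.sum_congr rfl fun y _ => ?_
    have h1 := sum_prod_simplex_eq_one fun i => μ i h (y i)
    calc _ = ∑ b : Fin n → A, (∏ l, (μ l h (y l)).1 (b l)) *
          ((∏ i, (M.nextLaw h fun t => η t i).1 (y i)) * g y) := by
          refine Finset.sum_congr rfl fun b _ => ?_
          rw [hqu, Finset.prod_mul_distrib]
          simp only [Equiv.arrowProdEquivProdArrow, Equiv.coe_fn_symm_mk]
          ring
      _ = _ := by rw [← Finset.sum_mul, h1, one_mul]
  have hq0 : ∀ h, DependsOn (q h) {j | j ≤ h} := by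
    intro h η η' hη
    refine Finset.prod_congr rfl fun i _ => M.dependsOn_stepProb (μ i) h fun j hj => ?_
    rw [hη j hj]
  have hq1 : ∀ h η, ∑ x, q h (Function.update η h x) = 1 := by
    intro h η
    have h2 := hfst η h fun _ => 1
    simp only [mul_one] at h2
    rw [h2]
    exact sum_prod_simplex_eq_one _
  have hswap : ∀ F : (Fin n → Fin H → S × A) → ℝ,
      M.dataExp μ F = ∑ η : Fin H → Fin n → S × A, (∏ h, q h η) * F fun i t => η t i := by
    intro F
    rw [← Equiv.sum_comp (Equiv.piComm fun (_ : Fin n) (_ : Fin H) => S × A)]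
    refine Finset.sum_congr rfl fun ω _ => ?_
    simp only [hq, pathProb]
    rw [Finset.prod_comm]
    rfl
  rw [hswap, hswap, sum_prod_mul_eq_sum_update hq0 hq1 k
    (G := fun η => G (fun i t => η t i) fun i => (η k i).1)]
  · refine Finset.sum_congr rfl fun η _ => ?_
    congr 1
    rw [← hfst]
    refine Finset.sum_congr rfl fun x _ => ?_
    congr 1
    simp only [Function.update_self]
    refine congrFun (hG _ _ fun i h hh => ?_) _
    rw [Function.update_of_ne]
    rintro rfl
    exact lt_irrefl _ hh
  · intro η η' hη
    simp only
    rw [hη k (le_refl k)]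
    refine congrFun (hG _ _ fun i h hh => ?_) _
    rw [hη h (Fin.le_def.2 (le_of_lt hh))]

lemma nextLaw_adapted (k : Fin H) {ω ω' : Fin n → Fin H → S × A}
    (h : ∀ i (t : Fin H), t.val < k.val → ω i t = ω' i t) (i : Fin n) :
    M.nextLaw k (ω i) = M.nextLaw k (ω' i) :=
  M.nextLaw_congr k fun j hj => h i j hj

/-- The mean of a predictable linear form in functions of the states at time `k`. -/
lemma dataExp_sum_mul_state (k : Fin H) (c : Fin n → (Fin n → Fin H → S × A) → ℝ)
    (hc : ∀ i, AdaptedBefore k (c i)) (g : S → ℝ) :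
    M.dataExp μ (fun ω => ∑ i, c i ω * g (ω i k).1) =
      M.dataExp μ fun ω => ∑ i, c i ω * ∑ s, (M.nextLaw k (ω i)).1 s * g s := by
  rw [M.dataExp_state μ k fun ω x => ∑ i, c i ω * g (x i)]
  · congr 1
    funext ω
    simp_rw [Finset.mul_sum]
    rw [Finset.sum_comm]
    refine Finset.sum_congr rfl fun i _ => ?_
    simp_rw [mul_left_comm (c i ω)]
    rw [← sum_prod_simplex_mul (fun i => M.nextLaw k (ω i)) i fun s => c i ω * g s]
  · intro ω ω' h
    funext x
    simp_rw [fun i => hc i ω ω' h]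

/-- One martingale step: a predictable variable `b` plus a predictable linear form in the
centred states at time `k`. The cross terms vanish. -/
lemma dataExp_add_sq (k : Fin H) (b : (Fin n → Fin H → S × A) → ℝ)
    (c : Fin n → (Fin n → Fin H → S × A) → ℝ) (hb : AdaptedBefore k b)
    (hc : ∀ i, AdaptedBefore k (c i)) (g : S → ℝ) :
    M.dataExp μ (fun ω => (b ω + ∑ i, c i ω *
        (g (ω i k).1 - ∑ s, (M.nextLaw k (ω i)).1 s * g s)) ^ 2) =
      M.dataExp μ fun ω => b ω ^ 2 + ∑ i, c i ω ^ 2 * simplexVar (M.nextLaw k (ω i)) g := by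
  rw [M.dataExp_state μ k fun ω x => (b ω + ∑ i, c i ω *
    (g (x i) - ∑ s, (M.nextLaw k (ω i)).1 s * g s)) ^ 2]
  · congr 1
    funext ω
    exact sum_prod_simplex_mul_sq (fun i => M.nextLaw k (ω i)) (b ω) (fun i => c i ω) g
  · intro ω ω' h
    funext x
    simp_rw [fun i => hc i ω ω' h, hb ω ω' h, M.nextLaw_adapted k h]

/-- The lower Chernoff bound for the number of visits to a state-action pair. -/
lemma dataExp_visits_lt (h : Fin H) (s : S) (a : A) [DecidableEq (S × A)] :
    M.dataExp μ (fun ω => if (∑ i, if ω i h = (s, a) then (1 : ℝ) else 0) <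
        (∑ i, M.occ (μ i) h s a) / 2 then 1 else 0) ≤
      Real.exp (-(∑ i, M.occ (μ i) h s a) / 8) := by
  set N := ∑ i, M.occ (μ i) h s a with hN
  -- Markov's inequality for `2 ^ (-count)`; as `log 2 ≤ 3 / 4`, this gives the rate `1 / 8`
  have hN0 : 0 ≤ N := Finset.sum_nonneg fun i _ => M.occ_nonneg _ _ _ _
  have h1 : ∀ ω : Fin n → Fin H → S × A,
      (if (∑ i, if ω i h = (s, a) then (1 : ℝ) else 0) < N / 2 then (1 : ℝ) else 0) ≤
        (∏ i, if ω i h = (s, a) then (1 / 2 : ℝ) else 1) * Real.exp (Real.log 2 * (N / 2)) := by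
    intro ω
    have h2 : (∏ i, if ω i h = (s, a) then (1 / 2 : ℝ) else 1) =
        Real.exp (Real.log 2 * -∑ i, if ω i h = (s, a) then (1 : ℝ) else 0) := by
      rw [← Finset.sum_neg_distrib, Finset.mul_sum, Real.exp_sum]
      refine Finset.prod_congr rfl fun i _ => ?_
      split_ifs
      · rw [mul_neg, mul_one, Real.exp_neg, Real.exp_log (by norm_num)]; norm_num
      · simp
    rw [h2, ← Real.exp_add]
    split_ifs with hlt
    · refine Real.one_le_exp ?_
      have := Real.log_pos (one_lt_two : (1 : ℝ) < 2)
      nlinarith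
    · positivity
  refine (M.dataExp_mono μ h1).trans ?_
  rw [dataExp_mul_const, M.dataExp_prod μ fun _ τ => if τ h = (s, a) then (1 / 2 : ℝ) else 1]
  have h3 : ∏ i, ∑ τ : Fin H → S × A, M.pathProb (μ i) τ *
      (if τ h = (s, a) then (1 / 2 : ℝ) else 1) ≤ Real.exp (-(N / 2)) := by
    have h4 : -(N / 2) = ∑ i, -(M.occ (μ i) h s a / 2) := by
      rw [hN, Finset.sum_neg_distrib, Finset.sum_div]
    rw [h4, Real.exp_sum]
    refine Finset.prod_le_prod (fun i _ => Finset.sum_nonneg fun τ _ =>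
      mul_nonneg (M.pathProb_nonneg _ _) (by split_ifs <;> norm_num)) fun i _ => ?_
    have h5 : ∑ τ : Fin H → S × A, M.pathProb (μ i) τ *
        (if τ h = (s, a) then (1 / 2 : ℝ) else 1) = 1 - M.occ (μ i) h s a / 2 := by
      rw [occ_eq_sum]
      refine (Finset.sum_congr rfl fun τ _ => ?_).trans ((Finset.sum_sub_distrib _ _).trans
        (congrArg₂ _ (M.sum_pathProb (μ i)) (Finset.sum_div _ _ _).symm))
      split_ifs <;> ring
    rw [h5]
    have := Real.add_one_le_exp (-(M.occ (μ i) h s a / 2))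
    linarith
  refine (mul_le_mul_of_nonneg_right h3 (Real.exp_pos _).le).trans ?_
  rw [← Real.exp_add]
  refine Real.exp_le_exp.2 ?_
  have := Real.log_two_lt_d9
  nlinarith

end MDP

namespace MDP

variable {S A : Type*} [Fintype S] [Fintype A] {H n : ℕ} (M : MDP S A H)

/-! ### The empirical model -/

/-- The data set observed along the trajectories `ω`. -/
def data (ω : Fin n → Fin H → S × A) : Dataset S A H n :=
  fun i h => ((ω i h).1, (ω i h).2, M.r h (ω i h).1 (ω i h).2)

variable (ω : Fin n → Fin H → S × A)

lemma visits_data (h : Fin H) (s : S) (a : A) [DecidableEq (S × A)] :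
    (visits (M.data ω) h s a : ℝ) = ∑ i, if ω i h = (s, a) then 1 else 0 := by
  classical
  unfold visits
  rw [Finset.card_filter]
  push_cast
  refine Finset.sum_congr rfl fun i _ => ?_
  exact if_congr (by simp [data, Prod.ext_iff]) rfl rfl

lemma data_congr {ω ω' : Fin n → Fin H → S × A} {i : Fin n} {h : Fin H} (hi : ω i h = ω' i h) :
    M.data ω i h = M.data ω' i h := by
  simp [data, hi]

lemma sum_visits_mul (h : Fin H) (F : S → A → ℝ) :
    ∑ s, ∑ a, (visits (M.data ω) h s a : ℝ) * F s a = ∑ i, F (ω i h).1 (ω i h).2 := by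
  classical
  simp_rw [visits_data, Finset.sum_mul]
  rw [← Fintype.sum_prod_type', Finset.sum_comm]
  refine Finset.sum_congr rfl fun i _ => ?_
  rw [Finset.sum_eq_single (ω i h)]
  · simp
  · intro x _ hx
    simp [hx.symm]
  · simp

lemma sum_PHat_mul {t : ℕ} (ht : t + 1 < H) (s : S) (a : A) (g : S → ℝ) [DecidableEq (S × A)] :
    ∑ s', PHat (M.data ω) ⟨t, by omega⟩ s a s' * g s' =
      (∑ i, if ω i ⟨t, by omega⟩ = (s, a) then g (ω i ⟨t + 1, ht⟩).1 else 0) /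
        visits (M.data ω) ⟨t, by omega⟩ s a := by
  classical
  have h : ∀ s', (transitions (M.data ω) ⟨t, by omega⟩ s a s' : ℝ) * g s' =
      ∑ i, if ω i ⟨t, by omega⟩ = (s, a) then
        (if (ω i ⟨t + 1, ht⟩).1 = s' then g s' else 0) else 0 := by
    intro s'
    unfold transitions
    rw [Finset.card_filter]
    push_cast
    rw [Finset.sum_mul]
    refine Finset.sum_congr rfl fun i _ => ?_
    simp only [data, ht, exists_true_left, ite_mul, one_mul, zero_mul, Prod.ext_iff]
    rw [← ite_and]
    simp only [and_assoc]
  unfold PHat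
  simp_rw [div_mul_eq_mul_div, h, ← Finset.sum_div]
  rw [Finset.sum_comm]
  congr 1
  refine Finset.sum_congr rfl fun i _ => ?_
  split_ifs <;> simp

/-- A weighted sum of empirical transition means, as a sum over the observed transitions. -/
lemma sum_mul_sum_PHat {t : ℕ} (ht : t + 1 < H) (w : S → A → ℝ) (g : S → ℝ) :
    ∑ s, ∑ a, w s a * ∑ s', PHat (M.data ω) ⟨t, by omega⟩ s a s' * g s' =
      ∑ i, w (ω i ⟨t, by omega⟩).1 (ω i ⟨t, by omega⟩).2 /
        visits (M.data ω) ⟨t, by omega⟩ (ω i ⟨t, by omega⟩).1 (ω i ⟨t, by omega⟩).2 *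
          g (ω i ⟨t + 1, ht⟩).1 := by
  classical
  simp_rw [M.sum_PHat_mul ω ht, Finset.sum_div, Finset.mul_sum]
  rw [← Fintype.sum_prod_type', Finset.sum_comm]
  refine Finset.sum_congr rfl fun i _ => ?_
  rw [Finset.sum_eq_single (ω i ⟨t, by omega⟩)]
  · simp only [Prod.mk.eta, if_true]
    ring
  · intro x _ hx
    simp [hx.symm]
  · simp

lemma PHat_nonneg {S A : Type*} {H n : ℕ} (D : Dataset S A H n) (h : Fin H) (s : S) (a : A)
    (s' : S) : 0 ≤ PHat D h s a s' := by
  unfold PHat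
  positivity

lemma sum_PHat_le_one {t : ℕ} (ht : t + 1 < H) (s : S) (a : A) :
    ∑ s', PHat (M.data ω) ⟨t, by omega⟩ s a s' ≤ 1 := by
  classical
  have h := M.sum_PHat_mul ω ht s a fun _ => 1
  simp only [mul_one] at h
  rw [h, ← visits_data]
  exact div_self_le_one _

lemma rHat_data (h : Fin H) (s : S) (a : A) :
    rHat (M.data ω) h s a = if visits (M.data ω) h s a = 0 then 0 else M.r h s a := by
  classical
  unfold rHat
  split_ifs with h0
  · simp [h0]
  have h0' : (visits (M.data ω) h s a : ℝ) ≠ 0 := by exact_mod_cast h0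
  rw [div_eq_iff h0', visits_data, Finset.mul_sum]
  refine Finset.sum_congr rfl fun i _ => ?_
  by_cases hi : ω i h = (s, a)
  · simp [data, hi]
  · have : ¬((ω i h).1 = s ∧ (ω i h).2 = a) := fun h => hi (Prod.ext h.1 h.2)
    simp [data, hi, this]

lemma visits_adapted (h : Fin H) (s : S) (a : A) :
    AdaptedBefore (h.val + 1) fun ω : Fin n → Fin H → S × A => visits (M.data ω) h s a := by
  intro ω ω' hω
  classical
  exact congrArg Finset.card (Finset.filter_congr fun i _ => by
    rw [M.data_congr (hω i h (Nat.lt_succ_self _))])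

lemma PHat_adapted (h : Fin H) (s : S) (a : A) (s' : S) :
    AdaptedBefore (h.val + 2) fun ω : Fin n → Fin H → S × A => PHat (M.data ω) h s a s' := by
  intro ω ω' hω
  have h1 : visits (M.data ω) h s a = visits (M.data ω') h s a :=
    M.visits_adapted h s a ω ω' fun i t ht => hω i t (by omega)
  have h2 : transitions (M.data ω) h s a s' = transitions (M.data ω') h s a s' := by
    have h3 : ∀ i, M.data ω i h = M.data ω' i h := fun i => M.data_congr (hω i h (by omega))
    have h4 : ∀ i (hn : h.val + 1 < H),
        M.data ω i ⟨h.val + 1, hn⟩ = M.data ω' i ⟨h.val + 1, hn⟩ :=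
      fun i hn => M.data_congr (hω i _ (Nat.lt_succ_self _))
    classical
    exact congrArg Finset.card (Finset.filter_congr fun i _ => by simp only [h3, h4])
  simp only [PHat, h1, h2]

variable (π : Policy S A H)

lemma dHat_adapted (t : ℕ) (s : S) :
    AdaptedBefore (t + 1) fun ω : Fin n → Fin H → S × A => dHat π (M.data ω) t s := by
  induction t generalizing s with
  | zero =>
    intro ω ω' hω
    by_cases hH : 0 < H
    · simp only [dHat, hH, dif_pos]
      congr 2
      classical
      exact congrArg Finset.card (Finset.filter_congr fun i _ => by
        rw [M.data_congr (hω i ⟨0, hH⟩ Nat.zero_lt_one)])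
    · simp [dHat, hH]
  | succ t ih =>
    intro ω ω' hω
    simp only [dHat]
    split_ifs with ht
    · refine Finset.sum_congr rfl fun s' _ => ?_
      have h1 : dHat π (M.data ω) t s' = dHat π (M.data ω') t s' :=
        ih s' ω ω' fun i h hh => hω i h (by omega)
      have h2 : ∀ a, PHat (M.data ω) ⟨t, ht⟩ s' a s = PHat (M.data ω') ⟨t, ht⟩ s' a s :=
        fun a => M.PHat_adapted ⟨t, ht⟩ s' a s ω ω' hω
      simp_rw [h1, h2]
    · rfl

lemma dHat_nonneg (D : Dataset S A H n) (t : ℕ) (s : S) : 0 ≤ dHat π D t s := by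
  induction t generalizing s with
  | zero => unfold dHat; split_ifs <;> positivity
  | succ t ih =>
    unfold dHat
    split_ifs
    · exact Finset.sum_nonneg fun s' _ => mul_nonneg (ih s') (Finset.sum_nonneg fun a _ =>
        mul_nonneg ((π _ _).2.1 _) (PHat_nonneg _ _ _ _ _))
    · exact le_rfl

lemma sum_dHat_zero_mul (hH : 0 < H) (g : S → ℝ) :
    ∑ s, dHat π (M.data ω) 0 s * g s = ∑ i, 1 / (n : ℝ) * g (ω i ⟨0, hH⟩).1 := by
  classical
  unfold dHat
  simp only [hH, dif_pos, Finset.card_filter]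
  push_cast
  simp_rw [div_mul_eq_mul_div, Finset.sum_mul, Finset.sum_div]
  rw [Finset.sum_comm]
  refine Finset.sum_congr rfl fun i _ => ?_
  rw [Finset.sum_eq_single (ω i ⟨0, hH⟩).1]
  · simp [data]
  · intro x _ hx
    simp [data, hx.symm]
  · simp

lemma sum_dHat_succ_mul {t : ℕ} (ht : t + 1 < H) (g : S → ℝ) :
    ∑ s', dHat π (M.data ω) (t + 1) s' * g s' =
      ∑ s, ∑ a, dHat π (M.data ω) t s * (π ⟨t, by omega⟩ s).1 a *
        ∑ s', PHat (M.data ω) ⟨t, by omega⟩ s a s' * g s' := by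
  have ht' : t < H := by omega
  simp only [dHat, ht', dif_pos, Finset.sum_mul, Finset.mul_sum]
  rw [Finset.sum_comm]
  refine Finset.sum_congr rfl fun s _ => ?_
  rw [Finset.sum_comm]
  refine Finset.sum_congr rfl fun a _ => Finset.sum_congr rfl fun s' _ => by ring

lemma sum_dHat_le_one {t : ℕ} (ht : t < H) : ∑ s, dHat π (M.data ω) t s ≤ 1 := by
  induction t with
  | zero =>
    have h := M.sum_dHat_zero_mul ω π ht fun _ => 1
    simp only [mul_one] at h
    rw [h]
    simpa using mul_inv_le_one
  | succ t ih =>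
    have h := M.sum_dHat_succ_mul ω π ht fun _ => 1
    simp only [mul_one] at h
    rw [h]
    refine le_trans ?_ (ih (by omega))
    refine Finset.sum_le_sum fun s _ => ?_
    calc _ ≤ ∑ a, dHat π (M.data ω) t s * (π ⟨t, by omega⟩ s).1 a * 1 :=
          Finset.sum_le_sum fun a _ => mul_le_mul_of_nonneg_left (M.sum_PHat_le_one ω ht s a)
            (mul_nonneg (dHat_nonneg π _ _ _) ((π _ _).2.1 _))
      _ = dHat π (M.data ω) t s := by
          simp_rw [mul_one, ← Finset.mul_sum, (π _ _).2.2, mul_one]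

/-! ### The estimator underestimates nonnegative rewards -/

/-- The plug-in estimate of the expected reward at time `h`, for the reward function `ρ`. -/
noncomputable def rewardHat (ρ : Fin H → S → A → ℝ) (h : Fin H) : ℝ :=
  ∑ s, ∑ a, dHat π (M.data ω) h s * (π h s).1 a *
    if visits (M.data ω) h s a = 0 then 0 else ρ h s a

lemma tmis_data : tmis π (M.data ω) = ∑ h, M.rewardHat ω π M.r h := by
  unfold tmis rewardHat
  simp_rw [rHat_data, Finset.mul_sum, mul_assoc]

lemma rewardHat_mono {ρ ρ' : Fin H → S → A → ℝ} (h : Fin H) (hρ : ∀ s a, ρ h s a ≤ ρ' h s a) :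
    M.rewardHat ω π ρ h ≤ M.rewardHat ω π ρ' h := by
  refine Finset.sum_le_sum fun s _ => Finset.sum_le_sum fun a _ => ?_
  refine mul_le_mul_of_nonneg_left ?_ (mul_nonneg (dHat_nonneg π _ _ _) ((π _ _).2.1 _))
  split_ifs
  · exact le_rfl
  · exact hρ s a

lemma rewardHat_linear (c : ℝ) (ρ ρ' : Fin H → S → A → ℝ) (h : Fin H) :
    M.rewardHat ω π (fun h s a => ρ h s a + c * ρ' h s a) h =
      M.rewardHat ω π ρ h + c * M.rewardHat ω π ρ' h := by
  unfold rewardHat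
  simp_rw [Finset.mul_sum, ← Finset.sum_add_distrib]
  refine Finset.sum_congr rfl fun s _ => Finset.sum_congr rfl fun a _ => ?_
  split_ifs <;> ring

lemma rewardHat_one_le (h : Fin H) : M.rewardHat ω π (fun _ _ _ => 1) h ≤ 1 := by
  refine le_trans ?_ (M.sum_dHat_le_one ω π h.isLt)
  unfold rewardHat
  refine Finset.sum_le_sum fun s _ => ?_
  calc _ ≤ ∑ a, dHat π (M.data ω) h s * (π h s).1 a * 1 :=
        Finset.sum_le_sum fun a _ => mul_le_mul_of_nonneg_left (by split_ifs <;> simp)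
          (mul_nonneg (dHat_nonneg π _ _ _) ((π _ _).2.1 _))
    _ = dHat π (M.data ω) h s := by
        simp_rw [mul_one, ← Finset.mul_sum, (π _ _).2.2, mul_one]

variable (μ : Fin n → Policy S A H)

/-- Mass of the estimated state distribution is lost at the unvisited state-action pairs, and
otherwise the empirical transitions are conditionally unbiased. For nonnegative rewards and
values, the collected reward plus the value-to-go is therefore a supermartingale. -/
lemma dataExp_rewardHat_add_le (ρ : Fin H → S → A → ℝ) (U : ℕ → S → ℝ) (hU0 : ∀ t s, 0 ≤ U t s)
    (hρ : ∀ h s a, 0 ≤ ρ h s a)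
    (hU : ∀ (h : Fin H) s, U h s = ∑ a, (π h s).1 a *
      (ρ h s a + ∑ s', (M.P h s a).1 s' * U (h + 1) s')) {T : ℕ} (hT : T < H) :
    M.dataExp μ (fun ω => ∑ t : Fin T, M.rewardHat ω π ρ ⟨t, by omega⟩ +
      ∑ s, dHat π (M.data ω) T s * U T s) ≤ ∑ s, M.d₁.1 s * U 0 s := by
  induction T with
  | zero =>
    simp only [Finset.univ_eq_empty, Finset.sum_empty, zero_add, sum_dHat_zero_mul _ _ _ hT]
    rw [M.dataExp_sum_mul_state μ ⟨0, hT⟩ (fun _ _ => 1 / (n : ℝ)) fun _ _ _ _ => rfl]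
    simp only [nextLaw, if_true, dataExp_const]
    rw [Finset.sum_const, Finset.card_univ, Fintype.card_fin, nsmul_eq_mul, ← mul_assoc]
    have h0 : 0 ≤ ∑ s, M.d₁.1 s * U 0 s :=
      Finset.sum_nonneg fun s _ => mul_nonneg (M.d₁.2.1 s) (hU0 _ _)
    refine mul_le_of_le_one_left h0 ?_
    simpa using mul_inv_le_one
  | succ T ih =>
    refine le_trans ?_ (ih (by omega))
    simp_rw [Fin.sum_univ_castSucc, sum_dHat_succ_mul _ _ _ hT,
      M.sum_mul_sum_PHat _ hT fun s a => dHat π _ T s * (π ⟨T, _⟩ s).1 a]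
    rw [dataExp_add, M.dataExp_sum_mul_state μ ⟨T + 1, hT⟩
      fun i ω => dHat π (M.data ω) T (ω i ⟨T, by omega⟩).1 *
        (π ⟨T, by omega⟩ (ω i ⟨T, by omega⟩).1).1 (ω i ⟨T, by omega⟩).2 /
          visits (M.data ω) ⟨T, by omega⟩ (ω i ⟨T, by omega⟩).1 (ω i ⟨T, by omega⟩).2,
      ← dataExp_add]
    · refine M.dataExp_mono μ fun ω => ?_
      rw [add_assoc]
      refine add_le_add le_rfl ?_
      simp only [nextLaw, Nat.succ_ne_zero, if_false, Nat.add_sub_cancel]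
      rw [← M.sum_visits_mul ω ⟨T, by omega⟩ fun s a => dHat π (M.data ω) T s *
        (π ⟨T, by omega⟩ s).1 a / visits (M.data ω) ⟨T, by omega⟩ s a *
          ∑ s', (M.P ⟨T, by omega⟩ s a).1 s' * U (T + 1) s']
      unfold rewardHat
      rw [← Finset.sum_add_distrib]
      refine Finset.sum_le_sum fun s _ => ?_
      rw [hU ⟨T, by omega⟩, ← Finset.sum_add_distrib, Finset.mul_sum]
      refine Finset.sum_le_sum fun a _ => ?_
      have hd := mul_nonneg (dHat_nonneg π (M.data ω) T s) ((π ⟨T, by omega⟩ s).2.1 a)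
      simp only [Fin.val_last]
      by_cases h0 : visits (M.data ω) ⟨T, by omega⟩ s a = 0
      · simp only [h0, if_true, Nat.cast_zero, zero_mul, mul_zero, add_zero]
        rw [← mul_assoc]
        exact mul_nonneg hd (add_nonneg (hρ _ _ _) (Finset.sum_nonneg fun s' _ =>
          mul_nonneg ((M.P _ _ _).2.1 _) (hU0 _ _)))
      · have h0' : (visits (M.data ω) ⟨T, by omega⟩ s a : ℝ) ≠ 0 := by exact_mod_cast h0
        rw [if_neg h0]
        refine le_of_eq ?_
        field_simp
    · intro i ω ω' hω
      simp only [hω i ⟨T, by omega⟩ (Nat.lt_succ_self _)]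
      have h1 : ∀ s, dHat π (M.data ω) T s = dHat π (M.data ω') T s :=
        fun s => M.dHat_adapted π T s ω ω' hω
      have h2 : ∀ s a, visits (M.data ω) ⟨T, by omega⟩ s a = visits (M.data ω') ⟨T, by omega⟩ s a :=
        fun s a => M.visits_adapted ⟨T, by omega⟩ s a ω ω' hω
      rw [h1, h2]

lemma dataExp_sum_rewardHat_le (ρ : Fin H → S → A → ℝ) (U : ℕ → S → ℝ) (hU0 : ∀ t s, 0 ≤ U t s)
    (hρ : ∀ h s a, 0 ≤ ρ h s a)
    (hU : ∀ (h : Fin H) s, U h s = ∑ a, (π h s).1 a *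
      (ρ h s a + ∑ s', (M.P h s a).1 s' * U (h + 1) s')) (hH : 0 < H) :
    M.dataExp μ (fun ω => ∑ h, M.rewardHat ω π ρ h) ≤ ∑ s, M.d₁.1 s * U 0 s := by
  obtain ⟨T, rfl⟩ : ∃ T, H = T + 1 := ⟨H - 1, by omega⟩
  refine le_trans (M.dataExp_mono μ fun ω => ?_)
    (M.dataExp_rewardHat_add_le π μ ρ U hU0 hρ hU (Nat.lt_succ_self T))
  rw [Fin.sum_univ_castSucc]
  refine add_le_add le_rfl ?_
  unfold rewardHat
  refine Finset.sum_le_sum fun s _ => ?_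
  have h := hU (Fin.last T) s
  simp only [Fin.val_last] at h ⊢
  rw [h, Finset.mul_sum]
  refine Finset.sum_le_sum fun a _ => ?_
  rw [← mul_assoc]
  refine mul_le_mul_of_nonneg_left ?_ (mul_nonneg (dHat_nonneg π _ _ _) ((π _ _).2.1 _))
  have h1 : 0 ≤ ∑ s', (M.P (Fin.last T) s a).1 s' * U (T + 1) s' :=
    Finset.sum_nonneg fun s' _ => mul_nonneg ((M.P _ _ _).2.1 _) (hU0 _ _)
  split_ifs
  · exact add_nonneg (hρ _ _ _) h1
  · exact le_add_of_nonneg_right h1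

lemma dataExp_sum_rewardHat_linear_le {c : ℝ} (hc : |c| = 1) (hH : 0 < H) :
    M.dataExp μ (fun ω => ∑ h, M.rewardHat ω π (fun _ _ _ => 1) h) +
      c * M.dataExp μ (fun ω => tmis π (M.data ω)) ≤ H + c * M.value π := by
  have hcb : ∀ {x b : ℝ}, |x| ≤ b → 0 ≤ b + c * x := by
    intro x b hx
    have := neg_abs_le (c * x)
    rw [abs_mul, hc, one_mul] at this
    linarith
  have h := M.dataExp_sum_rewardHat_le π μ (fun h s a => 1 + c * M.r h s a)
    (fun t s => ((H - t : ℕ) : ℝ) + c * M.V π t s) ?_ ?_ ?_ hH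
  · simp_rw [rewardHat_linear M _ π c (fun _ _ _ => 1) M.r, Finset.sum_add_distrib,
      ← Finset.mul_sum, ← tmis_data] at h
    rw [dataExp_add] at h
    simp_rw [mul_comm c] at h ⊢
    rw [dataExp_mul_const] at h
    refine h.trans (le_of_eq ?_)
    simp_rw [mul_add, Finset.sum_add_distrib, ← Finset.sum_mul, ← mul_assoc, ← Finset.sum_mul]
    rw [M.d₁.2.2, ← M.value_eq_sum_V π hH]
    simp
  · intro t s
    rcases le_or_gt t H with ht | ht
    · rw [Nat.cast_sub ht]
      exact hcb (M.abs_V_le π ht s)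
    · simp [V_of_le M π ht.le]
  · intro h s a
    exact hcb (abs_le.2 (M.r_mem h s a))
  · intro h s
    have h1 : ((H - h.val : ℕ) : ℝ) = (H - (h.val + 1) : ℕ) + 1 := by
      rw [← Nat.cast_succ]
      congr 1
      have := h.isLt
      omega
    have h2 : ∀ a, 1 + c * M.r h s a + ∑ s', (M.P h s a).1 s' *
        (((H - (h.val + 1) : ℕ) : ℝ) + c * M.V π (h.val + 1) s') =
        ((H - (h.val + 1) : ℕ) + 1 : ℝ) +
          c * (M.r h s a + ∑ s', (M.P h s a).1 s' * M.V π (h.val + 1) s') := by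
      intro a
      simp_rw [mul_add, Finset.sum_add_distrib, ← Finset.sum_mul, mul_left_comm _ c,
        ← Finset.mul_sum]
      rw [(M.P h s a).2.2]
      ring
    simp_rw [h2]
    rw [h1, M.V_eq π h s]
    simp_rw [mul_add ((π h s).1 _) _ (c * _), Finset.sum_add_distrib, ← Finset.sum_mul,
      mul_left_comm _ c, ← Finset.mul_sum]
    rw [(π h s).2.2, one_mul]

lemma abs_tmis_le (ω : Fin n → Fin H → S × A) :
    |tmis π (M.data ω)| ≤ ∑ h, M.rewardHat ω π (fun _ _ _ => 1) h := by
  rw [tmis_data]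
  refine (Finset.abs_sum_le_sum_abs _ _).trans (Finset.sum_le_sum fun h _ => abs_le.2 ⟨?_, ?_⟩)
  · have h1 := M.rewardHat_mono ω π (ρ := fun _ _ _ => 0)
      (ρ' := fun h s a => 1 + 1 * M.r h s a) h fun s a => by linarith [(M.r_mem h s a).1]
    rw [rewardHat_linear M ω π 1 (fun _ _ _ => 1) M.r] at h1
    simp only [rewardHat, ite_self, mul_zero, Finset.sum_const_zero] at h1 ⊢
    linarith
  · exact M.rewardHat_mono ω π h fun s a => (M.r_mem h s a).2

lemma sum_rewardHat_one_le (ω : Fin n → Fin H → S × A) :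
    ∑ h, M.rewardHat ω π (fun _ _ _ => 1) h ≤ H := by
  simpa using Finset.sum_le_sum fun h (_ : h ∈ Finset.univ) => M.rewardHat_one_le ω π h

lemma abs_value_le : |M.value π| ≤ H := by
  rw [value_eq]
  refine (Finset.abs_sum_le_sum_abs _ _).trans ?_
  calc _ ≤ ∑ _h : Fin H, (1 : ℝ) := by
        refine Finset.sum_le_sum fun h _ => ?_
        rw [← M.sum_occ π h]
        refine (Finset.abs_sum_le_sum_abs _ _).trans (Finset.sum_le_sum fun s _ => ?_)
        refine (Finset.abs_sum_le_sum_abs _ _).trans (Finset.sum_le_sum fun a _ => ?_)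
        rw [abs_mul, abs_of_nonneg (M.occ_nonneg π h s a)]
        exact mul_le_of_le_one_right (M.occ_nonneg π h s a) (abs_le.2 (M.r_mem h s a))
    _ = H := by simp

/-- The mean squared error of the estimator for the fixed logging policies `μ`. -/
noncomputable def mse : ℝ := M.dataExp μ fun ω => (tmis π (M.data ω) - M.value π) ^ 2

lemma mse_nonneg : 0 ≤ M.mse π μ := M.dataExp_nonneg μ fun _ => sq_nonneg _

/-- Without any exploration, the mean squared error is at most `H ^ 2`. Let `W` be the estimate
for the reward `1`. Then `|v̂| ≤ W ≤ H`, while underestimation for the rewards `1 + r` and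
`1 - r` gives `|v - E v̂| ≤ H - E W`; variance plus squared bias is thus at most
`H * E W + (H - E W) ^ 2 ≤ H ^ 2`. -/
lemma mse_le_sq : M.mse π μ ≤ (H : ℝ) ^ 2 := by
  rcases Nat.eq_zero_or_pos H with rfl | hH
  · have h1 : ∀ ω : Fin n → Fin 0 → S × A, (tmis π (M.data ω) - M.value π) ^ 2 = 0 := fun ω => by
      rw [value_eq]; simp [tmis]
    simp [mse, h1, dataExp_const]
  have h1 := M.dataExp_sum_rewardHat_linear_le π μ (c := 1) (by simp) hH
  have h2 := M.dataExp_sum_rewardHat_linear_le π μ (c := -1) (by simp) hH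
  set w := M.dataExp μ (fun ω => ∑ h, M.rewardHat ω π (fun _ _ _ => 1) h)
  set e := M.dataExp μ (fun ω => tmis π (M.data ω)) with he
  have hw0 : 0 ≤ w := M.dataExp_nonneg μ fun ω => (abs_nonneg _).trans (M.abs_tmis_le π ω)
  have hw1 : w ≤ H := by
    simpa [dataExp_const] using M.dataExp_mono μ (M.sum_rewardHat_one_le π)
  have h3 : M.mse π μ ≤ M.dataExp μ (fun ω => ((∑ h, M.rewardHat ω π (fun _ _ _ => 1) h) * H -
      tmis π (M.data ω) * (2 * M.value π)) + M.value π ^ 2) := by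
    refine M.dataExp_mono μ fun ω => ?_
    have h4 := M.abs_tmis_le π ω
    have h5 := M.sum_rewardHat_one_le π ω
    have h6 : tmis π (M.data ω) ^ 2 ≤ (∑ h, M.rewardHat ω π (fun _ _ _ => 1) h) * H := by
      rw [← sq_abs, sq]
      exact mul_le_mul h4 (h4.trans h5) (abs_nonneg _) ((abs_nonneg _).trans h4)
    nlinarith
  rw [dataExp_add, dataExp_sub, dataExp_mul_const, dataExp_mul_const, dataExp_const] at h3
  have h7 : (M.value π - e) ^ 2 ≤ (H - w) ^ 2 := by
    apply sq_le_sq' <;> linarith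
  nlinarith [sq_nonneg e]

end MDP

namespace MDP

variable {S A : Type*} [Fintype S] [Fintype A] {H n : ℕ} (M : MDP S A H)

/-! ### The fictitious estimator and its martingale decomposition -/

/-- The expected number of visits to `(s, a)` at time `h`. -/
noncomputable def meanVisits (μ : Fin n → Policy S A H) (h : Fin H) (s : S) (a : A) : ℝ :=
  ∑ i, M.occ (μ i) h s a

/-- The pair `(s, a)` is visited at time `h`, and at least half as often as expected. -/
def Reliable (μ : Fin n → Policy S A H) (ω : Fin n → Fin H → S × A) (h : Fin H) (s : S)
    (a : A) : Prop :=
  0 < visits (M.data ω) h s a ∧ M.meanVisits μ h s a / 2 ≤ visits (M.data ω) h s a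

open Classical in
/-- The state distribution of the fictitious estimator: as `dHat`, but with the true transition
law at the pairs that are visited too rarely. -/
noncomputable def dTilde (μ : Fin n → Policy S A H) (π : Policy S A H)
    (ω : Fin n → Fin H → S × A) : ℕ → S → ℝ
  | 0, s => dHat π (M.data ω) 0 s
  | t + 1, s' => if ht : t < H then
      ∑ s, dTilde μ π ω t s * ∑ a, (π ⟨t, ht⟩ s).1 a *
        (if M.Reliable μ ω ⟨t, ht⟩ s a then PHat (M.data ω) ⟨t, ht⟩ s a s'
          else (M.P ⟨t, ht⟩ s a).1 s') else 0

open Classical in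
/-- The weight of the `i`-th trajectory in the transition from time `t` to time `t + 1`. -/
noncomputable def stepWeight (μ : Fin n → Policy S A H) (π : Policy S A H) (t : Fin H)
    (i : Fin n) (ω : Fin n → Fin H → S × A) : ℝ :=
  if M.Reliable μ ω t (ω i t).1 (ω i t).2 then
    M.dTilde μ π ω t (ω i t).1 * (π t (ω i t).1).1 (ω i t).2 /
      visits (M.data ω) t (ω i t).1 (ω i t).2
  else 0

variable (μ : Fin n → Policy S A H) (π : Policy S A H)

lemma reliable_adapted (h : Fin H) (s : S) (a : A) :
    AdaptedBefore (h.val + 1) fun ω => M.Reliable μ ω h s a := by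
  intro ω ω' hω
  have h1 : visits (M.data ω) h s a = visits (M.data ω') h s a := M.visits_adapted h s a ω ω' hω
  simp only [Reliable, h1]

lemma dTilde_adapted (t : ℕ) (s : S) : AdaptedBefore (t + 1) fun ω => M.dTilde μ π ω t s := by
  classical
  induction t generalizing s with
  | zero => exact M.dHat_adapted π 0 s
  | succ t ih =>
    intro ω ω' hω
    simp only [dTilde]
    split_ifs with ht
    · refine Finset.sum_congr rfl fun s' _ => ?_
      have h1 : M.dTilde μ π ω t s' = M.dTilde μ π ω' t s' :=
        ih s' ω ω' fun i h hh => hω i h (by omega)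
      have h2 : ∀ a, PHat (M.data ω) ⟨t, ht⟩ s' a s = PHat (M.data ω') ⟨t, ht⟩ s' a s :=
        fun a => M.PHat_adapted ⟨t, ht⟩ s' a s ω ω' hω
      have h3 : ∀ a (x y : ℝ), (if M.Reliable μ ω ⟨t, ht⟩ s' a then x else y) =
          if M.Reliable μ ω' ⟨t, ht⟩ s' a then x else y := fun a x y =>
        if_congr (iff_of_eq (M.reliable_adapted μ ⟨t, ht⟩ s' a ω ω'
          fun i h hh => hω i h (Nat.lt_succ_of_lt hh))) rfl rfl
      simp_rw [h1, h2, h3]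
    · rfl

lemma stepWeight_adapted (t : Fin H) (i : Fin n) :
    AdaptedBefore (t.val + 1) (M.stepWeight μ π t i) := by
  classical
  intro ω ω' hω
  have h1 : ∀ s, M.dTilde μ π ω t s = M.dTilde μ π ω' t s :=
    fun s => M.dTilde_adapted μ π t s ω ω' hω
  have h2 : ∀ s a, visits (M.data ω) t s a = visits (M.data ω') t s a :=
    fun s a => M.visits_adapted t s a ω ω' hω
  have h3 : ∀ s a (x y : ℝ), (if M.Reliable μ ω t s a then x else y) =
      if M.Reliable μ ω' t s a then x else y := fun s a x y =>
    if_congr (iff_of_eq (M.reliable_adapted μ t s a ω ω' hω)) rfl rfl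
  unfold stepWeight
  rw [h3, hω i t (Nat.lt_succ_self _), h1, h2]

/-- One step of the fictitious estimator is an exact step of the MDP plus a martingale
difference. -/
lemma sum_dTilde_succ_mul (ω : Fin n → Fin H → S × A) {t : ℕ} (ht : t + 1 < H) (g : S → ℝ) :
    ∑ s', M.dTilde μ π ω (t + 1) s' * g s' =
      ∑ s, ∑ a, M.dTilde μ π ω t s * (π ⟨t, by omega⟩ s).1 a *
        ∑ s', (M.P ⟨t, by omega⟩ s a).1 s' * g s' +
      ∑ i, M.stepWeight μ π ⟨t, by omega⟩ i ω *
        (g (ω i ⟨t + 1, ht⟩).1 - ∑ s', (M.nextLaw ⟨t + 1, ht⟩ (ω i)).1 s' * g s') := by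
  classical
  have ht' : t < H := by omega
  set w : S → A → ℝ := fun s a => if M.Reliable μ ω ⟨t, ht'⟩ s a then
    M.dTilde μ π ω t s * (π ⟨t, ht'⟩ s).1 a else 0 with hw
  have hweight : ∀ i, M.stepWeight μ π ⟨t, ht'⟩ i ω =
      w (ω i ⟨t, ht'⟩).1 (ω i ⟨t, ht'⟩).2 /
        visits (M.data ω) ⟨t, ht'⟩ (ω i ⟨t, ht'⟩).1 (ω i ⟨t, ht'⟩).2 := by
    intro i
    simp only [stepWeight, hw]
    split_ifs <;> simp
  have h1 := M.sum_mul_sum_PHat ω ht w g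
  have h2 : ∑ i, w (ω i ⟨t, ht'⟩).1 (ω i ⟨t, ht'⟩).2 /
        visits (M.data ω) ⟨t, ht'⟩ (ω i ⟨t, ht'⟩).1 (ω i ⟨t, ht'⟩).2 *
          ∑ s', (M.nextLaw ⟨t + 1, ht⟩ (ω i)).1 s' * g s' =
      ∑ s, ∑ a, w s a * ∑ s', (M.P ⟨t, ht'⟩ s a).1 s' * g s' := by
    simp only [nextLaw, Nat.succ_ne_zero, if_false, Nat.add_sub_cancel]
    rw [← M.sum_visits_mul ω ⟨t, ht'⟩ fun s a => w s a / visits (M.data ω) ⟨t, ht'⟩ s a *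
      ∑ s', (M.P ⟨t, ht'⟩ s a).1 s' * g s']
    refine Finset.sum_congr rfl fun s _ => Finset.sum_congr rfl fun a _ => ?_
    simp only [hw]
    split_ifs with hr
    · have h0 : (visits (M.data ω) ⟨t, ht'⟩ s a : ℝ) ≠ 0 := by exact_mod_cast hr.1.ne'
      field_simp
    · simp
  simp_rw [hweight, mul_sub, Finset.sum_sub_distrib]
  rw [← h1, h2]
  simp only [← Finset.sum_sub_distrib, ← Finset.sum_add_distrib]
  simp only [dTilde, ht', dif_pos, Finset.sum_mul, Finset.mul_sum]
  rw [Finset.sum_comm]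
  refine Finset.sum_congr rfl fun s _ => ?_
  rw [Finset.sum_comm]
  refine Finset.sum_congr rfl fun a _ => ?_
  simp only [← Finset.sum_sub_distrib, ← Finset.sum_add_distrib]
  refine Finset.sum_congr rfl fun s' _ => ?_
  simp only [hw]
  split_ifs <;> ring

lemma sum_stepWeight_sq_le (hN : ∀ h s a, 0 < M.meanVisits μ h s a)
    (ω : Fin n → Fin H → S × A) {t : ℕ} (ht : t + 1 < H) (g : S → ℝ) :
    ∑ i, M.stepWeight μ π ⟨t, by omega⟩ i ω ^ 2 *
        simplexVar (M.nextLaw ⟨t + 1, ht⟩ (ω i)) g ≤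
      ∑ s, ∑ a, M.dTilde μ π ω t s ^ 2 * ((π ⟨t, by omega⟩ s).1 a ^ 2 *
        (2 / M.meanVisits μ ⟨t, by omega⟩ s a) * simplexVar (M.P ⟨t, by omega⟩ s a) g) := by
  classical
  have ht' : t < H := by omega
  simp only [nextLaw, Nat.succ_ne_zero, if_false, Nat.add_sub_cancel, stepWeight]
  rw [← M.sum_visits_mul ω ⟨t, ht'⟩ fun s a => (if M.Reliable μ ω ⟨t, ht'⟩ s a then
    M.dTilde μ π ω t s * (π ⟨t, ht'⟩ s).1 a / visits (M.data ω) ⟨t, ht'⟩ s a else 0) ^ 2 *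
      simplexVar (M.P ⟨t, ht'⟩ s a) g]
  refine Finset.sum_le_sum fun s _ => Finset.sum_le_sum fun a _ => ?_
  have hv := simplexVar_nonneg (M.P ⟨t, ht'⟩ s a) g
  have hN' := hN ⟨t, ht'⟩ s a
  split_ifs with hr
  · have h0 : (0 : ℝ) < visits (M.data ω) ⟨t, ht'⟩ s a := by exact_mod_cast hr.1
    have h1 : 1 / (visits (M.data ω) ⟨t, ht'⟩ s a : ℝ) ≤ 2 / M.meanVisits μ ⟨t, ht'⟩ s a := by
      rw [div_le_div_iff₀ h0 hN']
      linarith [hr.2]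
    calc _ = M.dTilde μ π ω t s ^ 2 * ((π ⟨t, ht'⟩ s).1 a ^ 2 *
          (1 / (visits (M.data ω) ⟨t, ht'⟩ s a : ℝ)) * simplexVar (M.P ⟨t, ht'⟩ s a) g) := by
          field_simp
      _ ≤ _ := by gcongr
  · simp only [ne_eq, OfNat.ofNat_ne_zero, not_false_eq_true, zero_pow, zero_mul, mul_zero]
    positivity

/-- The second moment of the error of the fictitious estimator with rewards `ρ` before time `T`
and terminal reward `U T`, by orthogonality of the martingale differences. -/
lemma dataExp_fictitious_sq_le (hn : 0 < n) (hN : ∀ h s a, 0 < M.meanVisits μ h s a)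
    (ρ : Fin H → S → A → ℝ) (U : ℕ → S → ℝ) {T : ℕ} (hT : T < H)
    (hU : ∀ t (ht : t < T) s, U t s = ∑ a, (π ⟨t, by omega⟩ s).1 a *
      (ρ ⟨t, by omega⟩ s a + ∑ s', (M.P ⟨t, by omega⟩ s a).1 s' * U (t + 1) s')) :
    M.dataExp μ (fun ω => (∑ t : Fin T, ∑ s, ∑ a, M.dTilde μ π ω t s *
        (π ⟨t, by omega⟩ s).1 a * ρ ⟨t, by omega⟩ s a +
          ∑ s, M.dTilde μ π ω T s * U T s - ∑ s, M.d₁.1 s * U 0 s) ^ 2) ≤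
      1 / n * simplexVar M.d₁ (U 0) + ∑ t : Fin T, ∑ s, ∑ a,
        M.dataExp μ (fun ω => M.dTilde μ π ω t s ^ 2) * ((π ⟨t, by omega⟩ s).1 a ^ 2 *
          (2 / M.meanVisits μ ⟨t, by omega⟩ s a) *
            simplexVar (M.P ⟨t, by omega⟩ s a) (U (t + 1))) := by
  have hn' : (n : ℝ) ≠ 0 := by exact_mod_cast hn.ne'
  induction T with
  | zero =>
    have h1 : ∀ ω : Fin n → Fin H → S × A,
        ∑ s, M.dTilde μ π ω 0 s * U 0 s - ∑ s, M.d₁.1 s * U 0 s =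
          0 + ∑ i, 1 / (n : ℝ) * (U 0 (ω i ⟨0, hT⟩).1 -
            ∑ s, (M.nextLaw ⟨0, hT⟩ (ω i)).1 s * U 0 s) := by
      intro ω
      simp only [dTilde, sum_dHat_zero_mul _ _ _ hT, nextLaw, if_true, mul_sub,
        Finset.sum_sub_distrib, Finset.sum_const, Finset.card_univ, Fintype.card_fin,
        nsmul_eq_mul]
      field_simp
      ring
    simp only [Finset.univ_eq_empty, Finset.sum_empty, zero_add, add_zero]
    simp_rw [h1]
    rw [M.dataExp_add_sq μ ⟨0, hT⟩ (fun _ => 0) (fun _ _ => 1 / (n : ℝ)) (fun _ _ _ => rfl)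
      fun _ _ _ _ => rfl]
    simp only [nextLaw, if_true, dataExp_const, Finset.sum_const, Finset.card_univ,
      Fintype.card_fin, nsmul_eq_mul]
    refine le_of_eq ?_
    field_simp
    ring
  | succ T ih =>
    have ih := ih (by omega) fun t ht s => hU t (by omega) s
    have hT' : T < H := by omega
    -- the error at time `T + 1` is the error at time `T` plus a martingale difference
    have h1 : ∀ ω : Fin n → Fin H → S × A,
        ∑ t : Fin (T + 1), ∑ s, ∑ a, M.dTilde μ π ω t s *
          (π ⟨t, by omega⟩ s).1 a * ρ ⟨t, by omega⟩ s a +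
            ∑ s, M.dTilde μ π ω (T + 1) s * U (T + 1) s - ∑ s, M.d₁.1 s * U 0 s =
        (∑ t : Fin T, ∑ s, ∑ a, M.dTilde μ π ω t s *
          (π ⟨t, by omega⟩ s).1 a * ρ ⟨t, by omega⟩ s a +
            ∑ s, M.dTilde μ π ω T s * U T s - ∑ s, M.d₁.1 s * U 0 s) +
        ∑ i, M.stepWeight μ π ⟨T, hT'⟩ i ω * (U (T + 1) (ω i ⟨T + 1, hT⟩).1 -
          ∑ s', (M.nextLaw ⟨T + 1, hT⟩ (ω i)).1 s' * U (T + 1) s') := by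
      intro ω
      have h2 : ∀ s, M.dTilde μ π ω T s * U T s = ∑ a, M.dTilde μ π ω T s * (π ⟨T, hT'⟩ s).1 a *
          (ρ ⟨T, hT'⟩ s a + ∑ s', (M.P ⟨T, hT'⟩ s a).1 s' * U (T + 1) s') := fun s => by
        rw [hU T (Nat.lt_succ_self T), Finset.mul_sum]
        simp_rw [← mul_assoc]
      rw [M.sum_dTilde_succ_mul μ π ω hT, Fin.sum_univ_castSucc]
      simp_rw [h2, mul_add (M.dTilde μ π ω T _ * _), Finset.sum_add_distrib]
      simp only [Fin.val_castSucc, Fin.val_last]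
      ring
    simp_rw [h1]
    rw [M.dataExp_add_sq μ ⟨T + 1, hT⟩ _ (M.stepWeight μ π ⟨T, hT'⟩),
      Fin.sum_univ_castSucc, ← add_assoc, dataExp_add]
    · refine add_le_add ih ?_
      refine (M.dataExp_mono μ fun ω => M.sum_stepWeight_sq_le μ π hN ω hT (U (T + 1))).trans ?_
      simp_rw [dataExp_sum, dataExp_mul_const]
      exact le_rfl
    · intro ω ω' hω
      have h2 : ∀ t ≤ T, ∀ s, M.dTilde μ π ω t s = M.dTilde μ π ω' t s := fun t ht s =>
        M.dTilde_adapted μ π t s ω ω' fun i h hh => hω i h (by simp only; omega)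
      have h3 : ∀ (t : Fin T) s, M.dTilde μ π ω t s = M.dTilde μ π ω' t s :=
        fun t => h2 t t.isLt.le
      simp only [h2 T le_rfl, h3]
    · exact M.stepWeight_adapted μ π ⟨T, hT'⟩

end MDP

namespace MDP

variable {S A : Type*} [Fintype S] [Fintype A] {H n : ℕ} (M : MDP S A H)
  (μ : Fin n → Policy S A H) (π : Policy S A H)

/-! ### The error of the fictitious estimator -/

/-- If the error of the fictitious state distribution is of order `τ d / n`, then the weight of a
pair in the next variance recursion exceeds its leading term by a term of lower order. -/
lemma secondMoment_weight_le (hn : 0 < n) {c τ : ℝ} (hc : 0 < c)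
    (hN : ∀ h s a, c ≤ M.meanVisits μ h s a) (hτ : 0 ≤ τ) {t : ℕ} (ht : t < H) (s : S) (a : A)
    (hy : M.dataExp μ (fun ω => (M.dTilde μ π ω t s - M.stateOcc π ⟨t, ht⟩ s) ^ 2) ≤
      8 * τ / n * M.stateOcc π ⟨t, ht⟩ s) :
    M.dataExp μ (fun ω => M.dTilde μ π ω t s ^ 2) *
        ((π ⟨t, ht⟩ s).1 a ^ 2 * (2 / M.meanVisits μ ⟨t, ht⟩ s a)) ≤
      4 * (M.occ π ⟨t, ht⟩ s a ^ 2 / M.meanVisits μ ⟨t, ht⟩ s a) +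
        32 * τ / (n * c) * M.occ π ⟨t, ht⟩ s a := by
  have hn' : (0 : ℝ) < n := by exact_mod_cast hn
  have hNc := hN ⟨t, ht⟩ s a
  have hN0 : 0 < M.meanVisits μ ⟨t, ht⟩ s a := lt_of_lt_of_le hc hNc
  have hd := M.stateOcc_nonneg π ⟨t, ht⟩ s
  have hp := (π ⟨t, ht⟩ s).2.1 a
  have hp1 : (π ⟨t, ht⟩ s).1 a ≤ 1 := by
    rw [← (π ⟨t, ht⟩ s).2.2]
    exact Finset.single_le_sum (fun a _ => (π ⟨t, ht⟩ s).2.1 a) (Finset.mem_univ a)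
  have h1 : M.dataExp μ (fun ω => M.dTilde μ π ω t s ^ 2) ≤
      2 * M.stateOcc π ⟨t, ht⟩ s ^ 2 + 2 * (8 * τ / n * M.stateOcc π ⟨t, ht⟩ s) := by
    refine le_trans (M.dataExp_mono μ (G := fun ω => 2 * M.stateOcc π ⟨t, ht⟩ s ^ 2 +
      (M.dTilde μ π ω t s - M.stateOcc π ⟨t, ht⟩ s) ^ 2 * 2) fun ω => ?_) ?_
    · nlinarith [sq_nonneg (M.dTilde μ π ω t s - 2 * M.stateOcc π ⟨t, ht⟩ s)]
    · rw [dataExp_add, dataExp_const, dataExp_mul_const]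
      linarith
  rw [occ_eq]
  set d := M.stateOcc π ⟨t, ht⟩ s
  set p := (π ⟨t, ht⟩ s).1 a
  set N := M.meanVisits μ ⟨t, ht⟩ s a
  calc _ ≤ (2 * d ^ 2 + 2 * (8 * τ / n * d)) * (p ^ 2 * (2 / N)) := by gcongr
    _ = 4 * ((d * p) ^ 2 / N) + 32 * τ / n * d * (p * p / N) := by ring
    _ ≤ 4 * ((d * p) ^ 2 / N) + 32 * τ / n * d * (p * 1 / c) := by gcongr
    _ = 4 * ((d * p) ^ 2 / N) + 32 * τ / (n * c) * (d * p) := by field_simp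

/-- The error of the fictitious state distribution. In the recursion for it, the one-step
variances of `P(s_T = s | s_t)` add up to at most `d_T(s)` by the law of total variance, so that no
factor `H` is lost and the recursion closes as soon as every pair is visited eight times in
expectation. -/
lemma dataExp_dTilde_sub_sq_le (hn : 0 < n) {c τ : ℝ} (hc : 8 ≤ c)
    (hN : ∀ h s a, c ≤ M.meanVisits μ h s a) (hτ1 : 1 ≤ τ)
    (hτ : ∀ h s a, n * M.occ π h s a ≤ τ * M.meanVisits μ h s a) {T : ℕ} (hT : T < H) (s : S) :
    M.dataExp μ (fun ω => (M.dTilde μ π ω T s - M.stateOcc π ⟨T, hT⟩ s) ^ 2) ≤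
      8 * τ / n * M.stateOcc π ⟨T, hT⟩ s := by
  classical
  induction T using Nat.strong_induction_on generalizing s with
  | _ T ih =>
    have hn' : (0 : ℝ) < n := by exact_mod_cast hn
    obtain ⟨U, hUT, hU⟩ := M.exists_backward π hT fun x => if x = s then 1 else 0
    have hU' : ∀ t (ht : t < T) s, U t s = ∑ a, (π ⟨t, by omega⟩ s).1 a *
        ((0 : ℝ) + ∑ s', (M.P ⟨t, by omega⟩ s a).1 s' * U (t + 1) s') := by
      simpa only [zero_add] using hU
    have h1 := M.dataExp_fictitious_sq_le μ π hn
      (fun h s a => lt_of_lt_of_le (by linarith) (hN h s a)) (fun _ _ _ => 0) U hT hU'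
    have h2 := M.sum_occ_reward_add π (fun _ _ _ => 0) U hT hU'
    have h3 := M.simplexVar_add_sum_le π U hT hU
    simp only [hUT, mul_zero, Finset.sum_const_zero, zero_add, mul_ite, mul_one,
      Finset.sum_ite_eq', Finset.mem_univ, if_true, ite_pow, one_pow, ne_eq,
      OfNat.ofNat_ne_zero, not_false_eq_true, zero_pow] at h1 h2 h3
    rw [← h2] at h1
    refine h1.trans (le_trans ?_ (mul_le_mul_of_nonneg_left h3
      (by positivity : (0 : ℝ) ≤ 8 * τ / n)))
    rw [mul_add, Finset.mul_sum]
    refine add_le_add (mul_le_mul_of_nonneg_right ?_ (simplexVar_nonneg _ _))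
      (Finset.sum_le_sum fun t _ => ?_)
    · exact div_le_div_of_nonneg_right (by linarith) hn'.le
    rw [Finset.mul_sum]
    refine Finset.sum_le_sum fun x _ => ?_
    rw [Finset.mul_sum]
    refine Finset.sum_le_sum fun a _ => ?_
    have htH : t.val < H := t.isLt.trans hT
    have hv := simplexVar_nonneg (M.P ⟨t, htH⟩ x a) (U (t + 1))
    rw [← mul_assoc, ← mul_assoc (8 * τ / n)]
    refine mul_le_mul_of_nonneg_right ?_ hv
    refine (M.secondMoment_weight_le μ π hn (by linarith) hN (by linarith) htH x a
      (ih t t.isLt htH x)).trans ?_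
    have ho := M.occ_nonneg π ⟨t, htH⟩ x a
    have hN0 : 0 < M.meanVisits μ ⟨t, htH⟩ x a := lt_of_lt_of_le (by linarith) (hN _ x a)
    have h4 : M.occ π ⟨t, htH⟩ x a ^ 2 / M.meanVisits μ ⟨t, htH⟩ x a ≤
        τ / n * M.occ π ⟨t, htH⟩ x a := by
      rw [div_mul_eq_mul_div, div_le_div_iff₀ hN0 hn']
      nlinarith [mul_le_mul_of_nonneg_right (hτ ⟨t, htH⟩ x a) ho]
    have h5 : 32 * τ / (n * c) ≤ 4 * τ / n := by
      rw [div_le_div_iff₀ (by positivity) hn']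
      have h6 : 0 ≤ 4 * τ * n := by positivity
      nlinarith [mul_le_mul_of_nonneg_left hc h6]
    have h6 := mul_le_mul_of_nonneg_right h5 ho
    -- the leading term contributes `4` and the recursive one `32 / c ≤ 4` to the constant `8`
    calc _ ≤ 4 * (τ / n * M.occ π ⟨t, htH⟩ x a) + 4 * τ / n * M.occ π ⟨t, htH⟩ x a := by
          linarith
      _ = _ := by ring

/-- The error of the fictitious estimator of the value. -/
lemma dataExp_fictitious_value_sq_le (hn : 0 < n) {c τ : ℝ} (hc : 8 ≤ c)
    (hN : ∀ h s a, c ≤ M.meanVisits μ h s a) (hτ1 : 1 ≤ τ)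
    (hτ : ∀ h s a, n * M.occ π h s a ≤ τ * M.meanVisits μ h s a) (hH : 0 < H) :
    M.dataExp μ (fun ω => (∑ h : Fin H, ∑ s, ∑ a, M.dTilde μ π ω h s * (π h s).1 a * M.r h s a -
        M.value π) ^ 2) ≤
      1 / n * simplexVar M.d₁ (M.V π 0) + ∑ h, ∑ s, ∑ a,
        4 * (M.occ π h s a ^ 2 / M.meanVisits μ h s a) * M.psi π h s a +
      32 * τ / (n * c) * H ^ 3 := by
  have hn' : (0 : ℝ) < n := by exact_mod_cast hn
  have h1 : ∀ h : Fin H, ∑ s, ∑ a, M.dataExp μ (fun ω => M.dTilde μ π ω h s ^ 2) *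
      ((π h s).1 a ^ 2 * (2 / M.meanVisits μ h s a) *
        simplexVar (M.P h s a) (M.V π (h.val + 1))) ≤
      ∑ s, ∑ a, 4 * (M.occ π h s a ^ 2 / M.meanVisits μ h s a) * M.psi π h s a +
        32 * τ / (n * c) * H ^ 2 := by
    intro h
    calc _ ≤ ∑ s, ∑ a, (4 * (M.occ π h s a ^ 2 / M.meanVisits μ h s a) * M.psi π h s a +
          32 * τ / (n * c) * H ^ 2 * M.occ π h s a) := by
          refine Finset.sum_le_sum fun s _ => Finset.sum_le_sum fun a _ => ?_
          have h2 := M.secondMoment_weight_le μ π hn (by linarith) hN (by linarith) h.isLt s a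
            (M.dataExp_dTilde_sub_sq_le μ π hn hc hN hτ1 hτ h.isLt s)
          have h3 := simplexVar_nonneg (M.P h s a) (M.V π (h.val + 1))
          have h4 : simplexVar (M.P h s a) (M.V π (h.val + 1)) ≤ (H : ℝ) ^ 2 := by
            refine simplexVar_le_sq _ fun s' => (M.abs_V_le π h.isLt s').trans ?_
            have : (0 : ℝ) ≤ ((h.val + 1 : ℕ) : ℝ) := by positivity
            linarith
          unfold psi
          rw [simplexVar_const_add, ← mul_assoc]
          refine (mul_le_mul_of_nonneg_right h2 h3).trans ?_
          rw [add_mul]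
          refine add_le_add le_rfl ?_
          rw [mul_right_comm]
          have := M.occ_nonneg π h s a
          gcongr
      _ = _ := by
          simp_rw [Finset.sum_add_distrib, ← Finset.mul_sum]
          rw [sum_occ, mul_one]
  obtain ⟨T, rfl⟩ : ∃ T, H = T + 1 := ⟨H - 1, by omega⟩
  have h2 := M.dataExp_fictitious_sq_le μ π hn
    (fun h s a => lt_of_lt_of_le (by linarith) (hN h s a)) M.r (M.V π) (Nat.lt_succ_self T)
    fun t ht s => M.V_eq π ⟨t, by omega⟩ s
  -- the last step has no transition, so the decomposition stops at the last state
  have h3 : ∀ ω s, M.dTilde μ π ω T s * M.V π T s =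
      ∑ a, M.dTilde μ π ω T s * (π (Fin.last T) s).1 a * M.r (Fin.last T) s a := by
    intro ω s
    have h := M.V_eq π (Fin.last T) s
    simp only [Fin.val_last, V_of_le M π le_rfl, mul_zero, Finset.sum_const_zero,
      add_zero] at h
    rw [h, Finset.mul_sum]
    simp_rw [← mul_assoc]
  rw [M.value_eq_sum_V π hH]
  simp_rw [h3] at h2
  have h4 : ∀ ω, ∑ h : Fin (T + 1), ∑ s, ∑ a, M.dTilde μ π ω h s * (π h s).1 a * M.r h s a =
      ∑ t : Fin T, ∑ s, ∑ a, M.dTilde μ π ω t s * (π ⟨t, by omega⟩ s).1 a *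
        M.r ⟨t, by omega⟩ s a + ∑ s, ∑ a,
          M.dTilde μ π ω T s * (π (Fin.last T) s).1 a * M.r (Fin.last T) s a := fun ω => by
    rw [Fin.sum_univ_castSucc]
    rfl
  simp_rw [h4]
  refine h2.trans ?_
  rw [add_assoc]
  refine add_le_add le_rfl ?_
  calc _ ≤ ∑ t : Fin T, (∑ s, ∑ a, 4 * (M.occ π t.castSucc s a ^ 2 /
        M.meanVisits μ t.castSucc s a) * M.psi π t.castSucc s a +
          32 * τ / (n * c) * ((T + 1 : ℕ) : ℝ) ^ 2) := Finset.sum_le_sum fun t _ => h1 t.castSucc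
    _ ≤ ∑ h : Fin (T + 1), (∑ s, ∑ a, 4 * (M.occ π h s a ^ 2 /
        M.meanVisits μ h s a) * M.psi π h s a +
          32 * τ / (n * c) * ((T + 1 : ℕ) : ℝ) ^ 2) := by
        rw [Fin.sum_univ_castSucc (n := T)]
        refine le_add_of_nonneg_right (add_nonneg (Finset.sum_nonneg fun s _ =>
          Finset.sum_nonneg fun a _ => ?_) (by positivity))
        have hN0 : 0 < M.meanVisits μ (Fin.last T) s a := lt_of_lt_of_le (by linarith) (hN _ s a)
        exact mul_nonneg (by positivity) (simplexVar_nonneg _ _)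
    _ = _ := by
        rw [Finset.sum_add_distrib, Finset.sum_const, Finset.card_univ, Fintype.card_fin,
          nsmul_eq_mul]
        ring

/-- When all pairs are reliable, the fictitious estimator is the estimator. -/
lemma tmis_eq_of_reliable (ω : Fin n → Fin H → S × A) (hω : ∀ h s a, M.Reliable μ ω h s a) :
    tmis π (M.data ω) =
      ∑ h : Fin H, ∑ s, ∑ a, M.dTilde μ π ω h s * (π h s).1 a * M.r h s a := by
  have h1 : ∀ t s, M.dTilde μ π ω t s = dHat π (M.data ω) t s := by
    intro t
    induction t with
    | zero => intro s; rfl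
    | succ t ih =>
      intro s
      simp only [dTilde, dHat, hω, if_true, ih]
  rw [tmis_data]
  refine Finset.sum_congr rfl fun h _ => Finset.sum_congr rfl fun s _ =>
    Finset.sum_congr rfl fun a _ => ?_
  rw [h1, if_neg (hω h s a).1.ne']

/-- The real error is the fictitious one unless some pair is unreliable, which has probability at
most `1 / n ^ 2` for each pair and costs at most `(2 H) ^ 2`. -/
lemma mse_le_of_meanVisits (hn : 0 < n) {c τ : ℝ} (hc : 8 ≤ c) (hlog : 16 * Real.log n ≤ c)
    (hN : ∀ h s a, c ≤ M.meanVisits μ h s a) (hτ1 : 1 ≤ τ)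
    (hτ : ∀ h s a, n * M.occ π h s a ≤ τ * M.meanVisits μ h s a) (hH : 0 < H) :
    M.mse π μ ≤ 1 / n * simplexVar M.d₁ (M.V π 0) + ∑ h, ∑ s, ∑ a,
        4 * (M.occ π h s a ^ 2 / M.meanVisits μ h s a) * M.psi π h s a +
      36 * τ / (n * c) * H ^ 3 := by
  classical
  have hn' : (0 : ℝ) < n := by exact_mod_cast hn
  set B : Fin H → S → A → (Fin n → Fin H → S × A) → ℝ := fun h s a ω =>
    if (∑ i, if ω i h = (s, a) then (1 : ℝ) else 0) < (∑ i, M.occ (μ i) h s a) / 2 then 1 else 0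
    with hB
  have hB0 : ∀ h s a ω, 0 ≤ B h s a ω := fun h s a ω => by
    simp only [hB]; split_ifs <;> norm_num
  have h1 : ∀ ω, (tmis π (M.data ω) - M.value π) ^ 2 ≤
      (∑ h : Fin H, ∑ s, ∑ a, M.dTilde μ π ω h s * (π h s).1 a * M.r h s a - M.value π) ^ 2 +
        (∑ h, ∑ s, ∑ a, B h s a ω) * (4 * H ^ 2) := by
    intro ω
    by_cases hω : ∀ h s a, M.Reliable μ ω h s a
    · rw [M.tmis_eq_of_reliable μ π ω hω]
      refine le_add_of_nonneg_right (mul_nonneg (Finset.sum_nonneg fun h _ =>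
        Finset.sum_nonneg fun s _ => Finset.sum_nonneg fun a _ => hB0 h s a ω) (by positivity))
    · push Not at hω
      obtain ⟨h, s, a, hr⟩ := hω
      have h2 : B h s a ω = 1 := by
        simp only [hB]
        rw [if_pos]
        rw [← visits_data]
        have hN0 : 0 < M.meanVisits μ h s a := lt_of_lt_of_le (by linarith) (hN h s a)
        by_contra hle
        refine hr ⟨?_, not_lt.1 hle⟩
        have h3 := not_lt.1 hle
        have h4 : (0 : ℝ) < visits (M.data ω) h s a := lt_of_lt_of_le (half_pos hN0) h3
        exact_mod_cast h4
      have h3 : 1 ≤ ∑ h, ∑ s, ∑ a, B h s a ω := by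
        rw [← h2]
        refine le_trans ?_ (Finset.single_le_sum (f := fun h => ∑ s, ∑ a, B h s a ω)
          (fun h _ => Finset.sum_nonneg fun s _ => Finset.sum_nonneg fun a _ => hB0 h s a ω)
          (Finset.mem_univ h))
        refine le_trans ?_ (Finset.single_le_sum (f := fun s => ∑ a, B h s a ω)
          (fun s _ => Finset.sum_nonneg fun a _ => hB0 h s a ω) (Finset.mem_univ s))
        exact Finset.single_le_sum (f := fun a => B h s a ω) (fun a _ => hB0 h s a ω)
          (Finset.mem_univ a)
      have h4 : (tmis π (M.data ω) - M.value π) ^ 2 ≤ 4 * H ^ 2 := by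
        have h5 := abs_le.1 ((M.abs_tmis_le π ω).trans (M.sum_rewardHat_one_le π ω))
        have h6 := abs_le.1 (M.abs_value_le π)
        nlinarith
      have h5 : 4 * (H : ℝ) ^ 2 ≤ (∑ h, ∑ s, ∑ a, B h s a ω) * (4 * H ^ 2) :=
        le_mul_of_one_le_left (by positivity) h3
      exact (h4.trans h5).trans (le_add_of_nonneg_left (sq_nonneg _))
  have h2 : ∀ h s a, M.dataExp μ (B h s a) ≤ 1 / n ^ 2 := by
    intro h s a
    refine (M.dataExp_visits_lt μ h s a).trans ?_
    have h3 : -(∑ i, M.occ (μ i) h s a) / 8 ≤ -(2 * Real.log n) := by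
      have := hN h s a
      unfold meanVisits at this
      linarith
    refine (Real.exp_le_exp.2 h3).trans (le_of_eq ?_)
    rw [Real.exp_neg, two_mul, Real.exp_add, Real.exp_log hn', one_div, sq]
  -- there are at most `n / c` pairs, as each of them is visited `c` times in expectation
  have hcard : ∑ _s : S, ∑ _a : A, (1 : ℝ) ≤ n / c := by
    rw [le_div_iff₀ (by linarith)]
    have h3 : ∑ s, ∑ a, M.meanVisits μ ⟨0, hH⟩ s a = n := by
      unfold meanVisits
      rw [← Fintype.sum_prod_type', Finset.sum_comm]
      simp_rw [Fintype.sum_prod_type (fun x : S × A => M.occ (μ _) ⟨0, hH⟩ x.1 x.2), sum_occ]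
      simp
    rw [← h3, Finset.sum_mul]
    refine Finset.sum_le_sum fun s _ => ?_
    rw [Finset.sum_mul]
    exact Finset.sum_le_sum fun a _ => by simpa using hN ⟨0, hH⟩ s a
  have h3 : ∑ h, ∑ s, ∑ a, M.dataExp μ (B h s a) ≤ H / (n * c) := by
    calc _ ≤ ∑ _h : Fin H, ∑ _s : S, ∑ _a : A, (1 : ℝ) * (1 / n ^ 2) :=
          Finset.sum_le_sum fun h _ => Finset.sum_le_sum fun s _ => Finset.sum_le_sum fun a _ => by
            simpa using h2 h s a
      _ ≤ ∑ _h : Fin H, (n / c * (1 / n ^ 2) : ℝ) := by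
          refine Finset.sum_le_sum fun h _ => ?_
          simp_rw [← Finset.sum_mul]
          exact mul_le_mul_of_nonneg_right hcard (by positivity)
      _ = H / (n * c) := by
          rw [Finset.sum_const, Finset.card_univ, Fintype.card_fin, nsmul_eq_mul]
          have : c ≠ 0 := by linarith
          field_simp
  refine (M.dataExp_mono μ h1).trans ?_
  rw [dataExp_add, dataExp_mul_const]
  simp_rw [dataExp_sum]
  have h4 := M.dataExp_fictitious_value_sq_le μ π hn hc hN hτ1 hτ hH
  have h5 := mul_le_mul_of_nonneg_right h3 (by positivity : (0 : ℝ) ≤ 4 * H ^ 2)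
  have h6 : (H : ℝ) / (n * c) * (4 * H ^ 2) ≤ 4 * τ / (n * c) * H ^ 3 := by
    have h7 : (0 : ℝ) ≤ 4 * H ^ 3 / (n * c) := by
      have : 0 < c := by linarith
      positivity
    calc (H : ℝ) / (n * c) * (4 * H ^ 2) = 4 * H ^ 3 / (n * c) * 1 := by ring
      _ ≤ 4 * H ^ 3 / (n * c) * τ := mul_le_mul_of_nonneg_left hτ1 h7
      _ = _ := by ring
  calc _ ≤ _ := add_le_add h4 (h5.trans h6)
    _ = _ := by ring

end MDP

namespace MDP

variable {S A : Type*} [Fintype S] [Fintype A] {H n : ℕ} (M : MDP S A H)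
  (μ : Fin n → Policy S A H) (π : Policy S A H)

/-! ### The error for fixed logging policies -/

lemma meanVisits_eq (hn : 0 < n) (h : Fin H) (s : S) (a : A) :
    M.meanVisits μ h s a = n * M.avgOcc μ h s a := by
  have : (n : ℝ) ≠ 0 := by exact_mod_cast hn.ne'
  unfold avgOcc meanVisits
  field_simp

lemma avgOcc_nonneg (h : Fin H) (s : S) (a : A) : 0 ≤ M.avgOcc μ h s a :=
  mul_nonneg (by positivity) (Finset.sum_nonneg fun i _ => M.occ_nonneg _ _ _ _)

lemma sum_avgOcc (hn : 0 < n) (h : Fin H) : ∑ s, ∑ a, M.avgOcc μ h s a = 1 := by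
  have hn' : (n : ℝ) ≠ 0 := by exact_mod_cast hn.ne'
  unfold avgOcc
  simp_rw [← Finset.mul_sum]
  rw [← Fintype.sum_prod_type', Finset.sum_comm]
  simp_rw [Fintype.sum_prod_type (fun x : S × A => M.occ (μ _) h x.1 x.2), sum_occ]
  simp [hn']

/-- `τ_a`, the largest ratio between the target policy and the average logging policy. -/
noncomputable def tauA {S A : Type*} [Fintype A] {H n : ℕ} (π : Policy S A H)
    (μ : Fin n → Policy S A H) : ℝ :=
  ⨆ x : Fin H × S × A, (π x.1 x.2.1).1 x.2.2 / ((1 / (n : ℝ)) * ∑ i, (μ i x.1 x.2.1).1 x.2.2)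

lemma nopeBound_eq (C : ℝ) : M.nopeBound C π μ =
    C * ((1 / (n : ℝ)) * (simplexVar M.d₁ (M.V π 0) + ∑ h : Fin H, ∑ s, ∑ a,
        M.stateOcc π h s ^ 2 * (π h s).1 a ^ 2 / M.avgOcc μ h s a * M.psi π h s a)) +
    C * (tauA π μ ^ 2 * M.tauS π μ * (H : ℝ) ^ 3 / ((n : ℝ) ^ 2 * M.minExploration μ)) := rfl

lemma psi_nonneg (h : Fin H) (s : S) (a : A) : 0 ≤ M.psi π h s a := simplexVar_nonneg _ _

lemma tauS_nonneg : 0 ≤ M.tauS π μ :=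
  Real.iSup_nonneg fun _ => div_nonneg (M.occ_nonneg _ _ _ _) (M.avgOcc_nonneg _ _ _ _)

lemma minExploration_nonneg : 0 ≤ M.minExploration μ :=
  Real.iInf_nonneg fun _ => M.avgOcc_nonneg _ _ _ _

lemma nopeBound_nonneg {C : ℝ} (hC : 0 ≤ C) : 0 ≤ M.nopeBound C π μ := by
  rw [nopeBound_eq]
  have h1 : 0 ≤ ∑ h : Fin H, ∑ s, ∑ a,
      M.stateOcc π h s ^ 2 * (π h s).1 a ^ 2 / M.avgOcc μ h s a * M.psi π h s a :=
    Finset.sum_nonneg fun h _ => Finset.sum_nonneg fun s _ => Finset.sum_nonneg fun a _ =>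
      mul_nonneg (div_nonneg (by positivity) (M.avgOcc_nonneg μ h s a)) (M.psi_nonneg π h s a)
  have h2 := simplexVar_nonneg M.d₁ (M.V π 0)
  have h3 := M.tauS_nonneg μ π
  have h4 := M.minExploration_nonneg μ
  positivity

section Explored

variable {dm : ℝ} {μ}

lemma occ_le_tauS_mul (hdm : 0 < dm) (hG : ∀ h s a, dm ≤ M.avgOcc μ h s a) (h : Fin H) (s : S)
    (a : A) : M.occ π h s a ≤ M.tauS π μ * M.avgOcc μ h s a := by
  rw [← div_le_iff₀ (hdm.trans_le (hG h s a))]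
  exact le_ciSup (f := fun x : Fin H × S × A => M.occ π x.1 x.2.1 x.2.2 /
    M.avgOcc μ x.1 x.2.1 x.2.2) (Set.finite_range _).bddAbove (h, s, a)

lemma one_le_tauS (hn : 0 < n) (hH : 0 < H) (hdm : 0 < dm)
    (hG : ∀ h s a, dm ≤ M.avgOcc μ h s a) : 1 ≤ M.tauS π μ := by
  calc (1 : ℝ) = ∑ s, ∑ a, M.occ π ⟨0, hH⟩ s a := (M.sum_occ π _).symm
    _ ≤ ∑ s, ∑ a, M.tauS π μ * M.avgOcc μ ⟨0, hH⟩ s a :=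
        Finset.sum_le_sum fun s _ => Finset.sum_le_sum fun a _ => M.occ_le_tauS_mul π hdm hG _ s a
    _ = M.tauS π μ := by
        simp_rw [← Finset.mul_sum]
        rw [M.sum_avgOcc μ hn, mul_one]

lemma avgOcc_le_avgPolicy (h : Fin H) (s : S) (a : A) :
    M.avgOcc μ h s a ≤ (1 / (n : ℝ)) * ∑ i, (μ i h s).1 a := by
  unfold avgOcc
  refine mul_le_mul_of_nonneg_left (Finset.sum_le_sum fun i _ => ?_) (by positivity)
  rw [occ_eq]
  exact mul_le_of_le_one_left ((μ i h s).2.1 a) (M.stateOcc_le_one _ _ _)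

lemma one_le_tauA (hn : 0 < n) (hH : 0 < H) (hdm : 0 < dm)
    (hG : ∀ h s a, dm ≤ M.avgOcc μ h s a) : 1 ≤ tauA π μ := by
  obtain ⟨s⟩ := M.nonempty_state
  have hn' : (n : ℝ) ≠ 0 := by exact_mod_cast hn.ne'
  calc (1 : ℝ) = ∑ a, (π ⟨0, hH⟩ s).1 a := (π _ s).2.2.symm
    _ ≤ ∑ a, tauA π μ * ((1 / (n : ℝ)) * ∑ i, (μ i ⟨0, hH⟩ s).1 a) := by
        refine Finset.sum_le_sum fun a _ => ?_
        rw [← div_le_iff₀ (hdm.trans_le ((hG _ s a).trans (M.avgOcc_le_avgPolicy _ s a)))]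
        exact le_ciSup (f := fun x : Fin H × S × A => (π x.1 x.2.1).1 x.2.2 /
          ((1 / (n : ℝ)) * ∑ i, (μ i x.1 x.2.1).1 x.2.2)) (Set.finite_range _).bddAbove
          (⟨0, hH⟩, s, a)
    _ = tauA π μ := by
        rw [← Finset.mul_sum, ← Finset.mul_sum, Finset.sum_comm]
        simp_rw [fun i => (μ i ⟨0, hH⟩ s).2.2]
        simp [hn']

lemma minExploration_le (h : Fin H) (s : S) (a : A) : M.minExploration μ ≤ M.avgOcc μ h s a :=
  ciInf_le (f := fun x : Fin H × S × A => M.avgOcc μ x.1 x.2.1 x.2.2)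
    (Set.finite_range _).bddBelow (h, s, a)

lemma le_minExploration (hn : 0 < n) (hH : 0 < H) (hG : ∀ h s a, dm ≤ M.avgOcc μ h s a) :
    dm ≤ M.minExploration μ := by
  obtain ⟨x⟩ := M.nonempty_stateAction (μ ⟨0, hn⟩) hH
  have : Nonempty (Fin H × S × A) := ⟨(⟨0, hH⟩, x)⟩
  exact le_ciInf fun x => hG _ _ _

lemma minExploration_le_one (hn : 0 < n) (hH : 0 < H) : M.minExploration μ ≤ 1 := by
  obtain ⟨s, a⟩ := M.nonempty_stateAction (μ ⟨0, hn⟩) hH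
  refine (M.minExploration_le ⟨0, hH⟩ s a).trans ?_
  rw [← M.sum_avgOcc μ hn ⟨0, hH⟩]
  refine (Finset.single_le_sum (f := fun a => M.avgOcc μ ⟨0, hH⟩ s a)
    (fun a _ => M.avgOcc_nonneg μ _ _ _) (Finset.mem_univ a)).trans ?_
  exact Finset.single_le_sum (f := fun s => ∑ a, M.avgOcc μ ⟨0, hH⟩ s a)
    (fun s _ => Finset.sum_nonneg fun a _ => M.avgOcc_nonneg μ _ _ _) (Finset.mem_univ s)

/-- The bound for fixed logging policies that explore every pair. -/
theorem mse_le_nopeBound (hdm : 0 < dm) (hlog : 16 * Real.log n / dm < n)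
    (hG : ∀ h s a, dm ≤ M.avgOcc μ h s a) : M.mse π μ ≤ M.nopeBound 36 π μ := by
  rcases Nat.eq_zero_or_pos H with rfl | hH
  · exact (M.mse_le_sq π μ).trans (by simpa using M.nopeBound_nonneg μ π (by norm_num))
  have hn : 0 < n := by
    rcases Nat.eq_zero_or_pos n with rfl | hn
    · simp at hlog
    · exact hn
  have hn' : (0 : ℝ) < n := by exact_mod_cast hn
  have hS := M.one_le_tauS π hn hH hdm hG
  have hA := M.one_le_tauA π hn hH hdm hG
  have hm := M.le_minExploration hn hH hG
  have hm0 := hdm.trans_le hm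
  have hAS : M.tauS π μ ≤ tauA π μ ^ 2 * M.tauS π μ :=
    le_mul_of_one_le_left (by linarith) (one_le_pow₀ hA)
  have hsum : 0 ≤ ∑ h : Fin H, ∑ s, ∑ a,
      M.stateOcc π h s ^ 2 * (π h s).1 a ^ 2 / M.avgOcc μ h s a * M.psi π h s a :=
    Finset.sum_nonneg fun h _ => Finset.sum_nonneg fun s _ => Finset.sum_nonneg fun a _ =>
      mul_nonneg (div_nonneg (by positivity) (M.avgOcc_nonneg μ h s a)) (M.psi_nonneg π h s a)
  have hv := simplexVar_nonneg M.d₁ (M.V π 0)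
  rcases Nat.lt_or_ge n 2 with h2 | h2
  · -- for a single trajectory, the second term alone exceeds `H ^ 2`
    obtain rfl : n = 1 := by omega
    refine (M.mse_le_sq π μ).trans ?_
    rw [nopeBound_eq]
    have hH' : (1 : ℝ) ≤ H := by exact_mod_cast hH
    have h3 : (H : ℝ) ^ 2 ≤ tauA π μ ^ 2 * M.tauS π μ * H ^ 3 /
        (((1 : ℕ) : ℝ) ^ 2 * M.minExploration μ) := by
      rw [Nat.cast_one, one_pow, one_mul, le_div_iff₀ hm0]
      have h4 := M.minExploration_le_one (μ := μ) hn hH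
      calc (H : ℝ) ^ 2 * M.minExploration μ ≤ (H : ℝ) ^ 2 * 1 := by gcongr
        _ ≤ 1 * (H : ℝ) ^ 3 := by nlinarith [pow_pos (by linarith : (0 : ℝ) < H) 2]
        _ ≤ tauA π μ ^ 2 * M.tauS π μ * (H : ℝ) ^ 3 := by
            gcongr
            linarith
    have h5 : 0 ≤ (36 : ℝ) * ((1 / ((1 : ℕ) : ℝ)) * (simplexVar M.d₁ (M.V π 0) + ∑ h : Fin H, ∑ s,
        ∑ a, M.stateOcc π h s ^ 2 * (π h s).1 a ^ 2 / M.avgOcc μ h s a * M.psi π h s a)) := by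
      positivity
    have h6 : (0 : ℝ) ≤ (H : ℝ) ^ 2 := by positivity
    linarith
  · have h16 : 16 * Real.log n ≤ n * M.minExploration μ := by
      rw [div_lt_iff₀ hdm] at hlog
      exact hlog.le.trans (mul_le_mul_of_nonneg_left hm hn'.le)
    have h8 : 8 ≤ n * M.minExploration μ := by
      have h9 : Real.log 2 ≤ Real.log n :=
        Real.log_le_log (by norm_num) (by exact_mod_cast h2)
      have := Real.log_two_gt_d9
      linarith
    refine (M.mse_le_of_meanVisits μ π hn h8 h16 (fun h s a => ?_) hS (fun h s a => ?_) hH).trans ?_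
    · rw [meanVisits_eq M μ hn]
      exact mul_le_mul_of_nonneg_left (M.minExploration_le h s a) hn'.le
    · rw [meanVisits_eq M μ hn, mul_left_comm]
      exact mul_le_mul_of_nonneg_left (M.occ_le_tauS_mul π hdm hG h s a) hn'.le
    · rw [nopeBound_eq, ← mul_assoc (n : ℝ), ← sq]
      have h3 : ∑ h : Fin H, ∑ s, ∑ a,
          4 * (M.occ π h s a ^ 2 / M.meanVisits μ h s a) * M.psi π h s a = 4 * (1 / n *
          ∑ h : Fin H, ∑ s, ∑ a,
            M.stateOcc π h s ^ 2 * (π h s).1 a ^ 2 / M.avgOcc μ h s a * M.psi π h s a) := by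
        simp_rw [Finset.mul_sum]
        refine Finset.sum_congr rfl fun h _ => Finset.sum_congr rfl fun s _ =>
          Finset.sum_congr rfl fun a _ => ?_
        rw [meanVisits_eq M μ hn, occ_eq]
        field_simp
      rw [h3]
      have h4 : 36 * M.tauS π μ / ((n : ℝ) ^ 2 * M.minExploration μ) * H ^ 3 ≤
          36 * (tauA π μ ^ 2 * M.tauS π μ * H ^ 3 / ((n : ℝ) ^ 2 * M.minExploration μ)) := by
        calc _ = 36 * (M.tauS π μ * H ^ 3 / ((n : ℝ) ^ 2 * M.minExploration μ)) := by ring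
          _ ≤ _ := by gcongr
      refine add_le_add ?_ h4
      have h5 : 0 ≤ 1 / (n : ℝ) * simplexVar M.d₁ (M.V π 0) := by positivity
      have h6 := mul_nonneg (by positivity : (0 : ℝ) ≤ 1 / n) hsum
      rw [mul_add (1 / (n : ℝ)) (simplexVar _ _)]
      linarith

end Explored

end MDP

/-! ### Measurability in the logging policies -/

instance (S A : Type*) (H : ℕ) : MeasurableSingletonClass (Trajectory S A H) := ⟨fun _ => trivial⟩

instance (S A : Type*) [Fintype S] [Fintype A] (H : ℕ) : Countable (Trajectory S A H) :=
  Finite.to_countable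

namespace MDP

lemma measurable_policy_apply {S A : Type*} [Fintype A] {H : ℕ} (h : Fin H) (s : S) (a : A) :
    Measurable fun π : Policy S A H => (π h s).1 a := by
  have h1 : Measurable fun π : Policy S A H => π h s :=
    (measurable_pi_apply s).comp (measurable_pi_apply h)
  exact (measurable_pi_apply a).comp (measurable_subtype_coe.comp h1)

variable {S A : Type*} [Fintype S] [Fintype A] {H n : ℕ} (M : MDP S A H)

lemma measurable_trajProb (τ : Trajectory S A H) :
    Measurable fun π : Policy S A H => M.trajProb π τ := by
  unfold trajProb
  exact Finset.measurable_fun_prod _ fun h _ =>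
    measurable_const.mul (measurable_policy_apply h _ _)

lemma measurable_occ (h : Fin H) (s : S) (a : A) :
    Measurable fun π : Policy S A H => M.occ π h s a := by
  unfold occ
  refine Finset.measurable_fun_sum _ fun τ _ => ?_
  split_ifs
  · exact M.measurable_trajProb τ
  · exact measurable_const

lemma measurable_avgOcc (h : Fin H) (s : S) (a : A) :
    Measurable fun μ : Fin n → Policy S A H => M.avgOcc μ h s a := by
  unfold avgOcc
  exact measurable_const.mul (Finset.measurable_fun_sum _ fun i _ =>
    (M.measurable_occ h s a).comp (measurable_pi_apply i))

lemma measurable_mse (π : Policy S A H) :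
    Measurable fun μ : Fin n → Policy S A H => M.mse π μ := by
  unfold mse dataExp
  refine Finset.measurable_fun_sum _ fun ω _ => Measurable.mul_const ?_ _
  refine Finset.measurable_fun_prod _ fun i _ => ?_
  simp_rw [← M.trajProb_eq_pathProb _ (ω i)]
  exact (M.measurable_trajProb (ω i)).comp (measurable_pi_apply i)

lemma measurable_nopeBound (C : ℝ) (π : Policy S A H) :
    Measurable fun μ : Fin n → Policy S A H => M.nopeBound C π μ := by
  have hA : Measurable fun μ : Fin n → Policy S A H => tauA π μ := by
    unfold tauA
    exact Measurable.iSup fun x => measurable_const.div (measurable_const.mul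
      (Finset.measurable_fun_sum _ fun i _ =>
        (measurable_policy_apply _ _ _).comp (measurable_pi_apply i)))
  have hS : Measurable fun μ : Fin n → Policy S A H => M.tauS π μ := by
    unfold tauS
    exact Measurable.iSup fun x => measurable_const.div (M.measurable_avgOcc _ _ _)
  have hm : Measurable fun μ : Fin n → Policy S A H => M.minExploration μ := by
    unfold minExploration
    exact Measurable.iInf fun x => M.measurable_avgOcc _ _ _
  simp_rw [nopeBound_eq]
  refine Measurable.add (measurable_const.mul (measurable_const.mul (measurable_const.add ?_)))
    (measurable_const.mul ((((hA.pow_const 2).mul hS).mul_const _).div (hm.const_mul _)))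
  exact Finset.measurable_fun_sum _ fun h _ => Finset.measurable_fun_sum _ fun s _ =>
    Finset.measurable_fun_sum _ fun a _ =>
      (measurable_const.div (M.measurable_avgOcc h s a)).mul_const _

/-- On policies with a fixed amount of exploration, `nopeBound` is bounded. -/
lemma exists_nopeBound_le {C dm : ℝ} (hC : 0 ≤ C) (hdm : 0 < dm) (π : Policy S A H) (hn : 0 < n) :
    ∃ K : ℝ, ∀ μ : Fin n → Policy S A H, (∀ h s a, dm ≤ M.avgOcc μ h s a) →
      M.nopeBound C π μ ≤ K := by
  rcases Nat.eq_zero_or_pos H with rfl | hH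
  · refine ⟨C * ((1 / n) * simplexVar M.d₁ (M.V π 0)), fun μ _ => ?_⟩
    simp [nopeBound_eq]
  have hn' : (0 : ℝ) < n := by exact_mod_cast hn
  refine ⟨C * ((1 / (n : ℝ)) * (simplexVar M.d₁ (M.V π 0) + ∑ h : Fin H, ∑ s, ∑ a,
        M.stateOcc π h s ^ 2 * (π h s).1 a ^ 2 / dm * M.psi π h s a)) +
    C * ((1 / dm) ^ 2 * (1 / dm) * (H : ℝ) ^ 3 / ((n : ℝ) ^ 2 * dm)), fun μ hG => ?_⟩
  have hm := M.le_minExploration hn hH hG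
  have hS0 := M.tauS_nonneg μ π
  have hA0 := zero_le_one.trans (M.one_le_tauA π hn hH hdm hG)
  have hp1 : ∀ h s a, (π h s).1 a ≤ 1 := fun h s a => by
    rw [← (π h s).2.2]
    exact Finset.single_le_sum (fun a _ => (π h s).2.1 a) (Finset.mem_univ a)
  have hA : tauA π μ ≤ 1 / dm := Real.iSup_le (fun x => div_le_div₀ zero_le_one (hp1 _ _ _) hdm
    ((hG _ _ _).trans (M.avgOcc_le_avgPolicy _ _ _))) (by positivity)
  have hS : M.tauS π μ ≤ 1 / dm := by
    refine Real.iSup_le (fun x => div_le_div₀ zero_le_one ?_ hdm (hG _ _ _)) (by positivity)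
    rw [occ_eq]
    exact mul_le_one₀ (M.stateOcc_le_one _ _ _) ((π _ _).2.1 _) (hp1 _ _ _)
  rw [nopeBound_eq]
  have hsum : ∑ h : Fin H, ∑ s, ∑ a,
      M.stateOcc π h s ^ 2 * (π h s).1 a ^ 2 / M.avgOcc μ h s a * M.psi π h s a ≤
    ∑ h : Fin H, ∑ s, ∑ a,
      M.stateOcc π h s ^ 2 * (π h s).1 a ^ 2 / dm * M.psi π h s a := by
    refine Finset.sum_le_sum fun h _ => Finset.sum_le_sum fun s _ =>
      Finset.sum_le_sum fun a _ => mul_le_mul_of_nonneg_right ?_ (M.psi_nonneg π h s a)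
    exact div_le_div_of_nonneg_left (by positivity) hdm (hG h s a)
  gcongr

end MDP

/-! ### The quasi-adaptive process -/

namespace LoggingAlgorithm

lemma measurable_policies_prodMk {Ξ : Type*} [MeasurableSpace Ξ] {S A : Type*} [Fintype A] {H n : ℕ}
    (E : LoggingAlgorithm Ξ S A H n)
    (y : (Fin n → Trajectory S A H) × (Fin n → Trajectory S A H)) (i : Fin n) :
    Measurable fun u => E.policies (u, y) i :=
  E.measurable_policy i fun j => y.1 ⟨j.val, j.isLt.trans i.isLt⟩

variable {Ξ : Type*} [MeasurableSpace Ξ] {S A : Type*} [Fintype S] [Fintype A] {H n : ℕ}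
  (E : LoggingAlgorithm Ξ S A H n) (M : MDP S A H) (ν : Measure Ξ) (π : Policy S A H)

lemma measurable_policies : Measurable E.policies :=
  measurable_pi_iff.2 fun i =>
    measurable_from_prod_countable_left fun y => E.measurable_policies_prodMk y i

/-- The density of `law`. -/
noncomputable def density (ω : Outcome Ξ S A H n) : ℝ :=
  ∏ i, M.trajProb (E.policies ω i) (ω.2.1 i) * M.trajProb (E.policies ω i) (ω.2.2 i)

lemma trajProb_nonneg (π : Policy S A H) (τ : Trajectory S A H) : 0 ≤ M.trajProb π τ := by
  rw [M.trajProb_eq_pathProb]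
  exact M.pathProb_nonneg π τ

lemma density_nonneg (ω : Outcome Ξ S A H n) : 0 ≤ E.density M ω :=
  Finset.prod_nonneg fun _ _ => mul_nonneg (trajProb_nonneg M _ _) (trajProb_nonneg M _ _)

lemma measurable_density : Measurable (E.density M) := by
  refine measurable_from_prod_countable_left fun y => ?_
  unfold density
  refine Finset.measurable_fun_prod _ fun i _ => ?_
  have h := E.measurable_policies_prodMk y i
  exact ((M.measurable_trajProb (y.1 i)).comp h).mul ((M.measurable_trajProb (y.2 i)).comp h)

/-- Integrating the shadow trajectories out: given the policies, they are independent. -/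
lemma sum_density_mul (u : Ξ) (τ : Fin n → Trajectory S A H)
    (f : (Fin n → Policy S A H) → (Fin n → Fin H → S × A) → ℝ) :
    ∑ τ' : Fin n → Trajectory S A H, E.density M (u, τ, τ') * f (E.policies (u, τ, τ')) τ' =
      (∏ i, M.trajProb (E.policies (u, τ, τ) i) (τ i)) *
        M.dataExp (E.policies (u, τ, τ)) (f (E.policies (u, τ, τ))) := by
  unfold MDP.dataExp
  rw [Finset.mul_sum]
  refine Finset.sum_congr rfl fun τ' _ => ?_
  have h : E.policies (u, τ, τ') = E.policies (u, τ, τ) := rfl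
  simp only [density, Finset.prod_mul_distrib, h]
  rw [mul_assoc]
  simp_rw [M.trajProb_eq_pathProb _ (τ' _)]

/-- The first trajectories have total probability one, whatever the algorithm does. -/
lemma sum_prod_trajProb_eq_one (hX : Nonempty (Trajectory S A H)) (u : Ξ) :
    ∑ τ : Fin n → Trajectory S A H, ∏ i, M.trajProb (E.policies (u, τ, τ) i) (τ i) = 1 := by
  refine sum_prod_eq_one (q := fun i τ => M.trajProb (E.policies (u, τ, τ) i) (τ i))
    (fun i τ τ' h => ?_) fun i τ => ?_
  · have h1 : E.policies (u, τ, τ) i = E.policies (u, τ', τ') i := by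
      unfold policies
      congr 1
      funext j
      exact h _ (Fin.le_def.2 j.isLt.le)
    change M.trajProb (E.policies (u, τ, τ) i) (τ i) = M.trajProb (E.policies (u, τ', τ') i) (τ' i)
    rw [h1, h i (le_refl i)]
  · have h1 : ∀ x, E.policies (u, Function.update τ i x, Function.update τ i x) i =
        E.policies (u, τ, τ) i := by
      intro x
      unfold policies
      congr 1
      funext j
      exact Function.update_of_ne (Fin.ne_of_lt (Fin.lt_def.2 j.isLt)) _ _
    simp_rw [h1, Function.update_self, M.trajProb_eq_pathProb]
    exact M.sum_pathProb _

lemma isProbabilityMeasure_law [IsProbabilityMeasure ν] (hX : Nonempty (Trajectory S A H)) :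
    IsProbabilityMeasure (E.law M ν) := by
  refine ⟨?_⟩
  have hmeas : Measurable fun ω => ENNReal.ofReal (E.density M ω) :=
    (E.measurable_density M).ennreal_ofReal
  have h1 : ∀ u, ∑ y : (Fin n → Trajectory S A H) × (Fin n → Trajectory S A H),
      E.density M (u, y) = 1 := by
    intro u
    rw [Fintype.sum_prod_type]
    have h2 := fun τ => E.sum_density_mul M u τ fun _ _ => 1
    simp only [mul_one, M.dataExp_const] at h2
    simp_rw [h2]
    exact E.sum_prod_trajProb_eq_one M hX u
  have h3 : ∀ u, ∑' y : (Fin n → Trajectory S A H) × (Fin n → Trajectory S A H),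
      ENNReal.ofReal (E.density M (u, y)) = 1 := by
    intro u
    rw [tsum_fintype, ← ENNReal.ofReal_sum_of_nonneg fun _ _ => E.density_nonneg M _, h1]
    simp
  change ((ν.prod Measure.count).withDensity fun ω => ENNReal.ofReal (E.density M ω)) Set.univ = 1
  rw [withDensity_apply _ MeasurableSet.univ, Measure.restrict_univ,
    lintegral_prod _ hmeas.aemeasurable]
  simp_rw [lintegral_count, h3]
  simp

lemma integral_law [IsProbabilityMeasure ν] {f : Outcome Ξ S A H n → ℝ}
    (hf : Integrable f (E.law M ν)) :
    ∫ ω, f ω ∂(E.law M ν) = ∫ u, ∑ y, E.density M (u, y) * f (u, y) ∂ν := by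
  have hmeas : Measurable fun ω => ENNReal.ofReal (E.density M ω) :=
    (E.measurable_density M).ennreal_ofReal
  have hlaw : E.law M ν =
    (ν.prod Measure.count).withDensity fun ω => ENNReal.ofReal (E.density M ω) := rfl
  rw [hlaw] at hf ⊢
  rw [integrable_withDensity_iff_integrable_smul' hmeas (by simp)] at hf
  rw [integral_withDensity_eq_integral_toReal_smul hmeas (by simp), integral_prod _ hf]
  simp_rw [integral_count, ENNReal.toReal_ofReal (E.density_nonneg M _), smul_eq_mul]

lemma integrable_mse [IsProbabilityMeasure ν] :
    Integrable (fun ω => M.mse π (E.policies ω)) (E.law M ν) := by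
  have := E.isProbabilityMeasure_law M ν (M.nonempty_path π)
  refine Integrable.of_bound (C := (H : ℝ) ^ 2)
    ((M.measurable_mse π).comp E.measurable_policies).aestronglyMeasurable ?_
  refine Filter.Eventually.of_forall fun ω => ?_
  rw [Real.norm_eq_abs, abs_of_nonneg (M.mse_nonneg π _)]
  exact M.mse_le_sq π _

/-- The error of the shadow data is the mean of the errors for the generated policies. -/
lemma shadowMSE_eq_integral_mse [IsProbabilityMeasure ν] :
    E.shadowMSE M ν π = ∫ ω, M.mse π (E.policies ω) ∂(E.law M ν) := by
  have := E.isProbabilityMeasure_law M ν (M.nonempty_path π)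
  have h1 : Integrable (fun ω => (tmis π (fun i => M.observe (ω.2.2 i)) - M.value π) ^ 2)
      (E.law M ν) := by
    refine Integrable.of_bound (C := (2 * H : ℝ) ^ 2) ?_ ?_
    · have h2 : Measurable fun τ' : Fin n → Trajectory S A H =>
          (tmis π (fun i => M.observe (τ' i)) - M.value π) ^ 2 := measurable_of_countable _
      exact (h2.comp (measurable_snd.comp measurable_snd)).aestronglyMeasurable
    · refine Filter.Eventually.of_forall fun ω => ?_
      have h5 := abs_le.1 ((M.abs_tmis_le π ω.2.2).trans (M.sum_rewardHat_one_le π ω.2.2))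
      have h6 := abs_le.1 (M.abs_value_le π)
      rw [Real.norm_eq_abs, abs_of_nonneg (sq_nonneg _)]
      change (tmis π (M.data ω.2.2) - M.value π) ^ 2 ≤ _
      apply sq_le_sq' <;> linarith
  have h2 := E.integrable_mse M ν π
  unfold shadowMSE
  rw [E.integral_law M ν h1, E.integral_law M ν h2]
  congr 1
  funext u
  rw [Fintype.sum_prod_type, Fintype.sum_prod_type]
  refine Finset.sum_congr rfl fun τ _ => ?_
  refine (E.sum_density_mul M u τ fun _ τ' => (tmis π (M.data τ') - M.value π) ^ 2).trans ?_
  refine Eq.trans ?_ (E.sum_density_mul M u τ fun μ _ => M.mse π μ).symm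
  rw [M.dataExp_const]
  rfl

lemma measurableSet_explorationEvent (dm : ℝ) : MeasurableSet (E.explorationEvent M dm) := by
  have h : E.explorationEvent M dm = ⋂ h, ⋂ s, ⋂ a, {ω | dm ≤ M.avgOcc (E.policies ω) h s a} := by
    ext ω
    simp [explorationEvent]
  rw [h]
  exact MeasurableSet.iInter fun h => MeasurableSet.iInter fun s => MeasurableSet.iInter fun a =>
    measurableSet_le measurable_const ((M.measurable_avgOcc h s a).comp E.measurable_policies)

end LoggingAlgorithm

end OPE

theorem mainTheorem7 :
    ∃ C : ℝ, 0 < C ∧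
      ∀ (S A Ξ : Type*) [Fintype S] [Fintype A] [MeasurableSpace Ξ]
        (ν : MeasureTheory.Measure Ξ) [MeasureTheory.IsProbabilityMeasure ν]
        (H n : ℕ) (M : OPE.MDP S A H) (π : OPE.Policy S A H)
        (E : OPE.LoggingAlgorithm Ξ S A H n) (dm δ : ℝ),
        0 < dm → 0 ≤ δ → δ ≤ 1 →
        16 * Real.log n / dm < n →
        1 - δ ≤ (E.law M ν).real (E.explorationEvent M dm) →
        E.shadowMSE M ν π ≤
          (1 - δ) * (∫ ω, M.nopeBound C π (E.policies ω)
            ∂(ProbabilityTheory.cond (E.law M ν) (E.explorationEvent M dm))) +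
          (H : ℝ) ^ 2 * δ := by
  -- `32` comes from the fictitious estimator and `4` from the unreliable pairs
  refine ⟨36, by norm_num, ?_⟩
  intro S A Ξ _ _ _ ν _ H n M π E dm δ hdm hδ0 hδ1 hlog hG
  have hn : 0 < n := by
    rcases Nat.eq_zero_or_pos n with rfl | hn
    · simp at hlog
    · exact hn
  have := E.isProbabilityMeasure_law M ν (M.nonempty_path π)
  set P := E.law M ν
  set G := E.explorationEvent M dm
  have hGm : MeasurableSet G := E.measurableSet_explorationEvent M dm
  have hmse : Integrable (fun ω => M.mse π (E.policies ω)) P := E.integrable_mse M ν π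
  -- without integrability, the conditional mean of the bound would be the junk value `0`
  have hB : IntegrableOn (fun ω => M.nopeBound 36 π (E.policies ω)) G P := by
    obtain ⟨K, hK⟩ := M.exists_nopeBound_le (n := n) (by norm_num : (0 : ℝ) ≤ 36) hdm π hn
    refine Integrable.of_bound (C := K)
      ((M.measurable_nopeBound 36 π).comp E.measurable_policies).aestronglyMeasurable ?_
    refine (ae_restrict_iff' hGm).2 (Filter.Eventually.of_forall fun ω hω => ?_)
    rw [Real.norm_eq_abs, abs_of_nonneg (M.nopeBound_nonneg _ π (by norm_num))]
    exact hK _ hω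
  set p := P.real G
  set x := ∫ ω in G, M.mse π (E.policies ω) ∂P
  set b := ∫ ω in G, M.nopeBound 36 π (E.policies ω) ∂P
  have hxb : x ≤ b := setIntegral_mono_on hmse.integrableOn hB hGm fun ω hω =>
    M.mse_le_nopeBound π hdm hlog hω
  have hsq : ∀ s, MeasurableSet s → ∫ ω in s, M.mse π (E.policies ω) ∂P ≤ P.real s * H ^ 2 := by
    intro s hs
    have h := setIntegral_mono_on (g := fun _ => (H : ℝ) ^ 2) hmse.integrableOn
      (integrable_const _) hs fun ω _ => M.mse_le_sq π (E.policies ω)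
    simpa using h
  have hx : x ≤ p * H ^ 2 := hsq G hGm
  have hy := hsq Gᶜ hGm.compl
  rw [probReal_compl_eq_one_sub hGm] at hy
  change _ ≤ (1 - p) * _ at hy
  have hsplit : E.shadowMSE M ν π = x + ∫ ω in Gᶜ, M.mse π (E.policies ω) ∂P := by
    rw [E.shadowMSE_eq_integral_mse, integral_add_compl hGm hmse]
  have hcond : ∫ ω, M.nopeBound 36 π (E.policies ω) ∂(ProbabilityTheory.cond P G) = p⁻¹ * b := by
    rw [ProbabilityTheory.cond, integral_smul_measure, ENNReal.toReal_inv, smul_eq_mul]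
    rfl
  rw [hsplit, hcond]
  have hp0 : 0 ≤ p := measureReal_nonneg
  rcases hp0.eq_or_lt with hp | hp
  · have hδ : δ = 1 := by linarith
    rw [← hp] at hx hy
    rw [hδ]
    linarith
  · -- moving the weight `p - (1 - δ)` from `x / p ≤ H ^ 2` to `H ^ 2` only increases the sum
    have h1 : (1 - δ) * (p⁻¹ * x) ≤ (1 - δ) * (p⁻¹ * b) := by
      have := inv_nonneg.2 hp0
      have : 0 ≤ 1 - δ := by linarith
      gcongr
    have h2 : p⁻¹ * x ≤ H ^ 2 := by
      rw [inv_mul_le_iff₀ hp]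
      exact hx
    have h3 : x = p * (p⁻¹ * x) := by field_simp
    nlinarith [mul_le_mul_of_nonneg_left h2 (sub_nonneg.2 hG)]
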